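/- Let $(X,D)$ be a compact metric space and $F\colon X\to X$ continuous. For an integer $T\ge 1$ put $D_T(x,y)=\max\{D(F^t(x),F^t(y)) : 0\le t<T\}$. For $\varepsilon>0$ let $cov(X,\varepsilon,D_T)$ be the minimum size of a cover of $X$ by sets $U$ such that $D_T(x,y)<\varepsilon$ for all $x,y\in U$; let $sep(X,\varepsilon,D_T)$ be the maximum size of a set $A\subseteq X$ with $D_T(x,y)\ge\varepsilon$ for all distinct $x,y\in A$; and let $span(X,\varepsilon,D_T)$ be the minimum size of a set $A\subseteq X$ such that every $x\in X$ satisfies $D_T(a,x)<\varepsilon$ for some $a\in A$. The topological entropy is $$h(X,F)=\lim_{\varepsilon\to 0^+}\limsup_{T\to\infty}\frac{\ln N_T(\varepsilon)}{T},$$ where $N_T(\varepsilon)$ is any one of $cov(X,\varepsilon,D_T)$, $sep(X,\varepsilon,D_T)$, $span(X,\varepsilon,D_T)$; all three give the same value. **Theorem.** There exist a metric space $(X^-,D)$ and a map $F\colon X^-\to X^-$ such that: (i) $X^-$ is compact with respect to $D$ and $F$ is a homeomorphism. (ii) For some $\varepsilon>0$ we have both $$\liminf_{T\to\infty}\frac{\ln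 span(X^-,\varepsilon,D_T)}{T}<\limsup_{T\to\infty}\frac{\ln span(X^-,\varepsilon,D_T)}{T}$$ and $$\liminf_{T\to\infty}\frac{\ln sep(X^-,\varepsilon,D_T)}{T}<\limsup_{T\to\infty}\frac{\ln sep(X^-,\varepsilon,D_T)}{T}.$$ (iii) $h(X^-,F)<\infty$. -/

import Mathlib

open Filter Topology
open scoped ENNReal

namespace BowenEntropy

/-- The dynamical distance `D_T(x, y) = max {D(F^t x, F^t y) : 0 ≤ t < T}` (used for `T ≥ 1`). -/
noncomputable def dynDist {X : Type*} [MetricSpace X] (F : X → X) (T : ℕ) (x y : X) : ℝ :=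
  ⨆ t : Fin T, dist (F^[(t : ℕ)] x) (F^[(t : ℕ)] y)

/-- `U` is an `ε`-cover of `X` with respect to `d`: it covers `X`, and any two points of one
member of `U` are at distance less than `ε`. -/
def IsEpsCover {X : Type*} (d : X → X → ℝ) (ε : ℝ) (U : Set (Set X)) : Prop :=
  ⋃₀ U = Set.univ ∧ ∀ V ∈ U, ∀ x ∈ V, ∀ y ∈ V, d x y < ε

/-- `A` is `ε`-separated with respect to `d`. -/
def IsEpsSeparated {X : Type*} (d : X → X → ℝ) (ε : ℝ) (A : Finset X) : Prop :=
  ∀ x ∈ A, ∀ y ∈ A, x ≠ y → ε ≤ d x y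

/-- `A` is `ε`-spanning in `X` with respect to `d`. -/
def IsEpsSpanning {X : Type*} (d : X → X → ℝ) (ε : ℝ) (A : Finset X) : Prop :=
  ∀ x : X, ∃ a ∈ A, d a x < ε

/-- The covering number `cov(X, ε, d)`: the minimum size of an `ε`-cover of `X`. -/
noncomputable def covNum {X : Type*} (d : X → X → ℝ) (ε : ℝ) : ℕ∞ :=
  ⨅ (U : Set (Set X)) (_ : IsEpsCover d ε U), U.encard

/-- The separation number `sep(X, ε, d)`: the maximum size of an `ε`-separated subset of `X`. -/
noncomputable def sepNum {X : Type*} (d : X → X → ℝ) (ε : ℝ) : ℕ∞ :=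
  ⨆ (A : Finset X) (_ : IsEpsSeparated d ε A), (A.card : ℕ∞)

/-- The spanning number `span(X, ε, d)`: the minimum size of an `ε`-spanning subset of `X`. -/
noncomputable def spanNum {X : Type*} (d : X → X → ℝ) (ε : ℝ) : ℕ∞ :=
  ⨅ (A : Finset X) (_ : IsEpsSpanning d ε A), (A.card : ℕ∞)

/-- The exponential growth rate `ln N / T` of a count `N` over `T` time steps, as an extended
real number (so that no convention about infinite or unbounded quantities is involved). -/
noncomputable def rate (N : ℕ∞) (T : ℕ) : EReal :=
  ENNReal.log (N : ℝ≥0∞) / (T : EReal)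

end BowenEntropy

/-! ### Growth rates. -/

namespace BowenEntropy

/-! The system is built from a hierarchy of words. A word of level `m + 1` consists of `numBlocks m`
words of level `m`; the first block is constant, and the code has enough redundancy that distinct
words differ in at least two blocks, yet the number of words stays exponential in the length. For
each pair of distinct words, `κ` singles out one block where they differ; recursively this yields a
single position at which the pair counts as fully distinguished (`FarAt`). Choosing `κ` at random
between two candidates leaves no large set of words whose pairs all select the same block
(`exists_coloring`).

Points are periodic: a word of level `3 * j` with a clock. The metric is a weighted sum of distances
with values 0, 1, 2, normalised so that the total is 1 exactly when the points are far at every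
level. At `ε = 1` the counts oscillate.

High times, `T = 2 * len (3 * j)`: a point that stays within distance less than 1 of a point
starting its period at level `3 * j` must equal it (`eq_start_of_dist_lt`), so spanning sets have at
least `numWords (3 * j)` elements.

Low times, `T = len (3 * j + 1)`: points of level at most `3 * j` are too few, since `T` is much
larger than `len (3 * j)`. For points of higher level, at least `3 * j + 3`, the times at which
pairs are distinguished all fall in a single block of level `3 * j + 2`, so after sorting by marks a
separated set is a monochromatic clique of `κ`, and its size is polynomial in `T`
(`card_le_of_farAt`, `card_separated_le`).

At each fixed scale, nets of size `C * 4 ^ T` (`exists_agree_net`) give total boundedness and finite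
entropy, and `exists_compact_system` transfers everything to the completion. -/

theorem rate_mono {N M : ℕ∞} (h : N ≤ M) (T : ℕ) : rate N T ≤ rate M T := by
  unfold rate
  apply EReal.div_le_div_right_of_nonneg (by exact_mod_cast Nat.zero_le T)
  apply ENNReal.log_monotone
  exact_mod_cast h

theorem rate_nonneg {N : ℕ∞} (h : 1 ≤ N) (T : ℕ) : 0 ≤ rate N T := by
  unfold rate
  apply EReal.div_nonneg _ (by exact_mod_cast Nat.zero_le T)
  rw [← ENNReal.log_one]
  apply ENNReal.log_monotone
  exact_mod_cast h

theorem rate_natCast {N : ℕ} (h : 1 ≤ N) (T : ℕ) :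
    rate (N : ℕ∞) T = ((Real.log N / T : ℝ) : EReal) := by
  unfold rate
  have h1 : (((N : ℕ∞) : ℝ≥0∞)) = ENNReal.ofReal (N : ℝ) := by
    simp
  rw [h1, ENNReal.log_ofReal_of_pos (by exact_mod_cast h)]
  rw [EReal.coe_div]
  rfl

/-! ### Comparison of covering, separation and spanning numbers. -/

section counts

variable {X : Type*} {d : X → X → ℝ} {ε : ℝ}

theorem covNum_anti (d : X → X → ℝ) : Antitone (covNum d) := by
  intro a b hab
  refine le_iInf₂ fun U hU => iInf₂_le U ⟨hU.1, fun V hV x hx y hy => ?_⟩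
  exact (hU.2 V hV x hx y hy).trans_le hab

theorem sepNum_le_covNum : sepNum d ε ≤ covNum d ε := by
  refine iSup₂_le fun A hA => le_iInf₂ fun U hU => ?_
  have h : ∀ x : X, ∃ V ∈ U, x ∈ V := fun x => by
    have : x ∈ ⋃₀ U := hU.1 ▸ Set.mem_univ x
    simpa using this
  choose V hVU hV using h
  rw [← Set.encard_coe_eq_coe_finsetCard]
  refine Set.encard_le_encard_of_injOn (f := V) (fun x _ => hVU x) ?_
  intro x hx y hy hxy
  by_contra hne
  exact absurd (hU.2 _ (hVU x) x (hV x) y (hxy ▸ hV y)) (not_lt.2 (hA x hx y hy hne))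

/-- A separated set of maximal size is spanning, since a point it misses could be added to it. -/
theorem spanNum_le_sepNum (hself : ∀ x, d x x < ε) (hsymm : ∀ x y, d x y = d y x) :
    spanNum d ε ≤ sepNum d ε := by
  classical
  by_cases htop : sepNum d ε = ⊤
  · rw [htop]; exact le_top
  obtain ⟨n, hn⟩ := ENat.ne_top_iff_exists.1 htop
  have hbound : ∀ A : Finset X, IsEpsSeparated d ε A → A.card ≤ n := fun A hA => by
    have : (A.card : ℕ∞) ≤ sepNum d ε := le_iSup₂_of_le A hA le_rfl
    rw [← hn] at this
    exact_mod_cast this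
  obtain ⟨A, hA, hmax⟩ : ∃ A : Finset X, IsEpsSeparated d ε A ∧
      ∀ B : Finset X, IsEpsSeparated d ε B → B.card ≤ A.card := by
    have hne : ∃ k, ∃ A : Finset X, IsEpsSeparated d ε A ∧ n - A.card = k :=
      ⟨_, ∅, by simp [IsEpsSeparated], rfl⟩
    obtain ⟨A, hA, hk⟩ := Nat.find_spec hne
    refine ⟨A, hA, fun B hB => ?_⟩
    have h1 := Nat.find_min' hne ⟨B, hB, rfl⟩
    have h2 := hbound B hB
    have h3 := hbound A hA
    omega
  refine (iInf₂_le A ?_).trans (le_iSup₂_of_le A hA le_rfl)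
  intro x
  by_contra! hx
  have hxA : x ∉ A := fun h => absurd (hself x) (not_lt.2 (hx x h))
  have := hmax (insert x A) ?_
  · rw [Finset.card_insert_of_notMem hxA] at this
    omega
  · intro y hy z hz hyz
    rw [Finset.mem_insert] at hy hz
    rcases hy with rfl | hy <;> rcases hz with rfl | hz
    · exact absurd rfl hyz
    · rw [hsymm]; exact hx z hz
    · exact hx y hy
    · exact hA y hy z hz hyz

theorem covNum_le_spanNum (hsymm : ∀ x y, d x y = d y x)
    (htri : ∀ x y z, d x z ≤ d x y + d y z) : covNum d (2 * ε) ≤ spanNum d ε := by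
  classical
  refine le_iInf₂ fun A hA => ?_
  have hU : IsEpsCover d (2 * ε) ((fun a => {x | d a x < ε}) '' (A : Set X)) := by
    refine ⟨Set.eq_univ_of_forall fun x => ?_, ?_⟩
    · obtain ⟨a, ha, hx⟩ := hA x
      exact ⟨_, ⟨a, ha, rfl⟩, hx⟩
    · rintro _ ⟨a, ha, rfl⟩ x hx y hy
      have h1 : d a x < ε := hx
      have h2 : d a y < ε := hy
      have := htri x a y
      rw [hsymm x a] at this
      linarith
  refine (iInf₂_le _ hU).trans ((Set.encard_image_le _ _).trans ?_)
  rw [Set.encard_coe_eq_coe_finsetCard]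

theorem one_le_covNum [Nonempty X] (d : X → X → ℝ) (ε : ℝ) : 1 ≤ covNum d ε := by
  refine le_iInf₂ fun U hU => ?_
  rw [Set.one_le_encard_iff_nonempty, Set.nonempty_iff_ne_empty]
  rintro rfl
  have := hU.1
  simp at this
  exact (Set.univ_nonempty (α := X)).ne_empty this.symm

end counts

/-! ### Dynamical distances and the common value of the entropies. -/

section dyn

variable {X : Type*} [MetricSpace X] (F : X → X) (T : ℕ)

theorem dist_le_dynDist {t : ℕ} (ht : t < T) (x y : X) :
    dist (F^[t] x) (F^[t] y) ≤ dynDist F T x y :=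
  le_ciSup (f := fun t : Fin T => dist (F^[(t : ℕ)] x) (F^[(t : ℕ)] y))
    (Set.finite_range _).bddAbove ⟨t, ht⟩

theorem dynDist_lt_iff {ε : ℝ} (hε : 0 < ε) {x y : X} :
    dynDist F T x y < ε ↔ ∀ t < T, dist (F^[t] x) (F^[t] y) < ε := by
  refine ⟨fun h t ht => (dist_le_dynDist F T ht x y).trans_lt h, fun h => ?_⟩
  rcases Nat.eq_zero_or_pos T with rfl | hT
  · simpa [dynDist] using hε
  · have : Nonempty (Fin T) := ⟨⟨0, hT⟩⟩
    obtain ⟨t, ht⟩ := exists_eq_ciSup_of_finite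
      (f := fun t : Fin T => dist (F^[(t : ℕ)] x) (F^[(t : ℕ)] y))
    unfold dynDist
    rw [← ht]
    exact h t t.2

theorem dynDist_self (x : X) : dynDist F T x x = 0 := by
  simp [dynDist]

theorem dynDist_comm (x y : X) : dynDist F T x y = dynDist F T y x := by
  simp [dynDist, dist_comm]

theorem dynDist_nonneg (x y : X) : 0 ≤ dynDist F T x y :=
  Real.iSup_nonneg fun _ => dist_nonneg

theorem dynDist_triangle (x y z : X) :
    dynDist F T x z ≤ dynDist F T x y + dynDist F T y z := by
  refine Real.iSup_le (fun t => ?_) (add_nonneg (dynDist_nonneg F T x y) (dynDist_nonneg F T y z))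
  exact (dist_triangle _ (F^[(t : ℕ)] y) _).trans
    (add_le_add (dist_le_dynDist F T t.2 x y) (dist_le_dynDist F T t.2 y z))

/-- If the covering numbers grow at most at a fixed exponential rate, the three definitions of
topological entropy converge to a common finite value. -/
theorem exists_entropy [Nonempty X] (c : ℝ)
    (hc : ∀ ε > 0, limsup (fun T : ℕ => rate (covNum (dynDist F T) ε) T) atTop ≤ (c : EReal)) :
    ∃ h : ℝ,
      Tendsto (fun ε : ℝ => limsup (fun T : ℕ => rate (covNum (dynDist F T) ε) T) atTop)
        (𝓝[>] 0) (𝓝 (h : EReal)) ∧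
      Tendsto (fun ε : ℝ => limsup (fun T : ℕ => rate (sepNum (dynDist F T) ε) T) atTop)
        (𝓝[>] 0) (𝓝 (h : EReal)) ∧
      Tendsto (fun ε : ℝ => limsup (fun T : ℕ => rate (spanNum (dynDist F T) ε) T) atTop)
        (𝓝[>] 0) (𝓝 (h : EReal)) := by
  set f : ℝ → EReal := fun ε => limsup (fun T : ℕ => rate (covNum (dynDist F T) ε) T) atTop
    with hf
  have hanti : Antitone f := fun a b hab =>
    limsup_le_limsup (Eventually.of_forall fun T => rate_mono (covNum_anti _ hab) T)
  have hlim : Tendsto f (𝓝[>] 0) (𝓝 (sSup (f '' Set.Ioi 0))) := hanti.tendsto_nhdsGT 0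
  have hnonneg : ∀ ε, 0 ≤ f ε := fun ε => by
    refine le_limsup_of_frequently_le' (Frequently.of_forall fun T => ?_)
    exact rate_nonneg (one_le_covNum _ _) T
  have h1 : sSup (f '' Set.Ioi 0) ≤ (c : EReal) := by
    refine sSup_le ?_
    rintro _ ⟨ε, hε, rfl⟩
    exact hc ε hε
  have h0 : 0 ≤ sSup (f '' Set.Ioi 0) :=
    (hnonneg 1).trans (le_sSup ⟨1, by simp, rfl⟩)
  have hcoe : ((sSup (f '' Set.Ioi 0)).toReal : EReal) = sSup (f '' Set.Ioi 0) := by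
    apply EReal.coe_toReal
    · exact (h1.trans_lt (EReal.coe_lt_top c)).ne
    · exact (lt_of_lt_of_le EReal.bot_lt_zero h0).ne'
  refine ⟨(sSup (f '' Set.Ioi 0)).toReal, ?_⟩
  rw [hcoe]
  have htwo : Tendsto (fun ε : ℝ => 2 * ε) (𝓝[>] 0) (𝓝[>] 0) := by
    refine tendsto_nhdsWithin_iff.2 ⟨?_, ?_⟩
    · have : Tendsto (fun ε : ℝ => 2 * ε) (𝓝 0) (𝓝 (2 * 0)) := by
        exact (continuous_const.mul continuous_id).tendsto 0
      rw [mul_zero] at this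
      exact this.mono_left nhdsWithin_le_nhds
    · filter_upwards [self_mem_nhdsWithin] with ε hε
      exact mul_pos two_pos (Set.mem_Ioi.1 hε)
  -- The counts satisfy `cov (2ε) ≤ span ε ≤ sep ε ≤ cov ε`, so both remaining limits are squeezed
  -- between `f (2 * ε)` and `f ε`.
  have hlim2 : Tendsto (fun ε => f (2 * ε)) (𝓝[>] 0) (𝓝 (sSup (f '' Set.Ioi 0))) :=
    hlim.comp htwo
  have hspan_sep : ∀ ε : ℝ, 0 < ε → ∀ T,
      spanNum (dynDist F T) ε ≤ sepNum (dynDist F T) ε := fun ε hε T =>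
    spanNum_le_sepNum (fun x => by rw [dynDist_self]; exact hε) (dynDist_comm F T)
  have hcov_span : ∀ ε : ℝ, ∀ T,
      covNum (dynDist F T) (2 * ε) ≤ spanNum (dynDist F T) ε := fun ε T =>
    covNum_le_spanNum (dynDist_comm F T) (dynDist_triangle F T)
  refine ⟨hlim, ?_, ?_⟩
  · refine tendsto_of_tendsto_of_tendsto_of_le_of_le' hlim2 hlim ?_ ?_
    · filter_upwards [self_mem_nhdsWithin] with ε hε
      exact limsup_le_limsup (Eventually.of_forall fun T =>
        rate_mono ((hcov_span ε T).trans (hspan_sep ε hε T)) T)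
    · exact Eventually.of_forall fun ε => limsup_le_limsup (Eventually.of_forall fun T =>
        rate_mono sepNum_le_covNum T)
  · refine tendsto_of_tendsto_of_tendsto_of_le_of_le' hlim2 hlim ?_ ?_
    · exact Eventually.of_forall fun ε => limsup_le_limsup (Eventually.of_forall fun T =>
        rate_mono (hcov_span ε T) T)
    · filter_upwards [self_mem_nhdsWithin] with ε hε
      exact limsup_le_limsup (Eventually.of_forall fun T =>
        rate_mono ((hspan_sep ε hε T).trans sepNum_le_covNum) T)

end dyn

/-! ### Transfer from a totally bounded system to its completion. -/

open UniformSpace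

theorem compactSpace_completion {Y : Type*} [UniformSpace Y]
    (h : TotallyBounded (Set.univ : Set Y)) : CompactSpace (Completion Y) := by
  have h1 : TotallyBounded (Set.range ((↑) : Y → Completion Y)) := by
    rw [← Set.image_univ]
    exact h.image (Completion.uniformContinuous_coe Y)
  have h2 := h1.closure
  rw [(Completion.denseRange_coe (α := Y)).closure_range] at h2
  exact ⟨h2.isCompact_of_isClosed isClosed_univ⟩

section

variable {Y : Type} [MetricSpace Y] (F : Y ≃ᵤ Y)

theorem iterate_mapEquiv_coe (t : ℕ) (y : Y) :
    (Completion.mapEquiv F)^[t] (y : Completion Y) = ((F^[t] y : Y) : Completion Y) := by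
  induction t generalizing y with
  | zero => rfl
  | succ t ih => simp only [Function.iterate_succ, Function.comp, Completion.mapEquiv_coe, ih]

theorem continuous_iterate_mapEquiv (t : ℕ) :
    Continuous ((Completion.mapEquiv F)^[t]) :=
  (Completion.mapEquiv F).continuous.iterate t

theorem exists_approx (x : Completion Y) (T : ℕ) {η : ℝ} (hη : 0 < η) :
    ∃ y : Y, ∀ t < T, dist ((Completion.mapEquiv F)^[t] x)
      ((F^[t] y : Y) : Completion Y) < η := by
  have hev : ∀ᶠ z in 𝓝 x, ∀ t ∈ Finset.range T,
      dist ((Completion.mapEquiv F)^[t] x) ((Completion.mapEquiv F)^[t] z) < η := by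
    rw [Filter.eventually_all_finset]
    intro t _
    have := (continuous_iterate_mapEquiv F t).tendsto x
    have := Metric.tendsto_nhds.1 this η hη
    filter_upwards [this] with z hz
    rwa [dist_comm]
  obtain ⟨y, hy⟩ := (Completion.denseRange_coe (α := Y)).exists_mem_open
    isOpen_interior ⟨x, mem_interior_iff_mem_nhds.2 hev⟩
  refine ⟨y, fun t ht => ?_⟩
  have := interior_subset hy t (Finset.mem_range.2 ht)
  rwa [iterate_mapEquiv_coe] at this

theorem spanNum_mapEquiv_le {T : ℕ} {ε : ℝ} (hε : 0 < ε) {A : Finset Y}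
    (hA : ∀ y, ∃ a ∈ A, ∀ t < T, dist (F^[t] a) (F^[t] y) < ε / 2) :
    spanNum (dynDist (Completion.mapEquiv F) T) ε ≤ A.card := by
  classical
  refine (iInf₂_le (A.image ((↑) : Y → Completion Y)) ?_).trans ?_
  · intro x
    obtain ⟨y, hy⟩ := exists_approx F x T (half_pos hε)
    obtain ⟨a, ha, h⟩ := hA y
    refine ⟨a, Finset.mem_image_of_mem _ ha, (dynDist_lt_iff _ _ hε).2 fun t ht => ?_⟩
    rw [iterate_mapEquiv_coe]
    have h1 := h t ht
    have h2 := hy t ht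
    rw [← Completion.dist_eq] at h1
    have h3 := dist_triangle_right ((F^[t] a : Y) : Completion Y)
      ((Completion.mapEquiv F)^[t] x) ((F^[t] y : Y) : Completion Y)
    linarith
  · exact_mod_cast Finset.card_image_le

/-- Replacing each point of the completion by a nearby point of `Y` costs a little distance; this is
why the hypothesis is about separation by `1 - δ` and not by 1. -/
theorem sepNum_mapEquiv_le {T : ℕ} {δ : ℝ} (hδ : 0 < δ) (hδ1 : δ < 1) {K : ℕ}
    (hK : ∀ A : Finset Y, (∀ x ∈ A, ∀ y ∈ A, x ≠ y →
      ∃ t < T, 1 - δ < dist (F^[t] x) (F^[t] y)) → A.card ≤ K) :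
    sepNum (dynDist (Completion.mapEquiv F) T) 1 ≤ K := by
  classical
  refine iSup₂_le fun A hA => ?_
  choose g hg using fun x : Completion Y => exists_approx F x T (show 0 < δ / 3 by positivity)
  have key : ∀ x ∈ A, ∀ y ∈ A, x ≠ y → ∃ t < T, 1 - δ < dist (F^[t] (g x)) (F^[t] (g y)) := by
    intro x hx y hy hxy
    have h1 : ¬ dynDist (Completion.mapEquiv F) T x y < 1 := not_lt.2 (hA x hx y hy hxy)
    rw [dynDist_lt_iff _ _ one_pos] at h1
    push Not at h1
    obtain ⟨t, ht, h1⟩ := h1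
    refine ⟨t, ht, ?_⟩
    have h2 := hg x t ht
    have h3 := hg y t ht
    rw [← Completion.dist_eq]
    have h4 := dist_triangle4_right ((Completion.mapEquiv F)^[t] x)
      ((Completion.mapEquiv F)^[t] y) ((F^[t] (g x) : Y) : Completion Y)
      ((F^[t] (g y) : Y) : Completion Y)
    linarith
  have hinj : Set.InjOn g A := by
    intro x hx y hy hxy
    by_contra hne
    obtain ⟨t, _, h⟩ := key x hx y hy hne
    rw [hxy, dist_self] at h
    linarith
  rw [← Finset.card_image_of_injOn hinj]
  refine Nat.cast_le.2 (hK _ ?_)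
  intro x hx y hy hxy
  obtain ⟨x', hx', rfl⟩ := Finset.mem_image.1 hx
  obtain ⟨y', hy', rfl⟩ := Finset.mem_image.1 hy
  exact key x' hx' y' hy' fun h => hxy (h ▸ rfl)

/-- No centre can serve two elements of `S`. Centres lie in the completion, but the strict
inequality leaves room to move them into `Y`. -/
theorem le_spanNum_mapEquiv {T : ℕ} {S : Finset Y}
    (hS : ∀ u ∈ S, ∀ v ∈ S, ∀ a, (∀ t < T, dist (F^[t] a) (F^[t] u) < 1) →
      (∀ t < T, dist (F^[t] a) (F^[t] v) < 1) → u = v) :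
    (S.card : ℕ∞) ≤ spanNum (dynDist (Completion.mapEquiv F) T) 1 := by
  classical
  refine le_iInf₂ fun A hA => Nat.cast_le.2 ?_
  choose g hgA hg using fun u : Y => hA (u : Completion Y)
  refine Finset.card_le_card_of_injOn g (fun u _ => hgA u) ?_
  intro u hu v hv huv
  have h1 := hg u
  have h2 := hg v
  rw [← huv] at h2
  set r := max (dynDist (Completion.mapEquiv F) T (g u) u)
    (dynDist (Completion.mapEquiv F) T (g u) v) with hr
  have hr1 : r < 1 := max_lt h1 h2
  -- The slack `1 - r` keeps the approximating point within distance less than 1 of both orbits.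
  obtain ⟨a, ha⟩ := exists_approx F (g u) T (sub_pos.2 hr1)
  have key : ∀ w : Y, dynDist (Completion.mapEquiv F) T (g u) w ≤ r →
      ∀ t < T, dist (F^[t] a) (F^[t] w) < 1 := by
    intro w hw t ht
    have h3 := (dist_le_dynDist (Completion.mapEquiv F) T ht (g u) w).trans hw
    rw [iterate_mapEquiv_coe] at h3
    have h4 := ha t ht
    rw [← Completion.dist_eq]
    have h5 := dist_triangle_left ((F^[t] a : Y) : Completion Y)
      ((F^[t] w : Y) : Completion Y) ((Completion.mapEquiv F)^[t] (g u))
    linarith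
  exact hS u hu v hv a (key u (le_max_left _ _)) (key v (le_max_right _ _))

theorem limsup_covNum_mapEquiv_le {b : ℕ} (hb : 1 ≤ b)
    (hspan : ∀ ε > 0, ∃ C : ℕ, 1 ≤ C ∧ ∀ T, ∃ A : Finset Y, A.card ≤ C * b ^ T ∧
      ∀ y, ∃ a ∈ A, ∀ t < T, dist (F^[t] a) (F^[t] y) < ε) {ε : ℝ} (hε : 0 < ε) :
    limsup (fun T : ℕ => rate (covNum (dynDist (Completion.mapEquiv F) T) ε) T) atTop ≤
      ((Real.log b + 1 : ℝ) : EReal) := by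
  obtain ⟨C, hC, h⟩ := hspan (ε / 2 / 2) (by positivity)
  refine limsup_le_of_le (by isBoundedDefault) ?_
  have hlarge : ∀ᶠ T : ℕ in atTop, Real.log C ≤ T :=
    tendsto_natCast_atTop_atTop.eventually_ge_atTop _
  filter_upwards [hlarge, eventually_gt_atTop 0] with T hT hT0
  obtain ⟨A, hcard, hA⟩ := h T
  have h1 := spanNum_mapEquiv_le F (half_pos hε) hA
  have h2 : covNum (dynDist (Completion.mapEquiv F) T) (2 * (ε / 2)) ≤
      spanNum (dynDist (Completion.mapEquiv F) T) (ε / 2) :=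
    covNum_le_spanNum (dynDist_comm _ T) (dynDist_triangle _ T)
  rw [mul_div_cancel₀ _ (two_ne_zero' ℝ)] at h2
  have h3 : covNum (dynDist (Completion.mapEquiv F) T) ε ≤ ((C * b ^ T : ℕ) : ℕ∞) :=
    (h2.trans h1).trans (Nat.cast_le.2 hcard)
  have hpos : 1 ≤ C * b ^ T := Nat.mul_pos hC (pow_pos hb T)
  refine (rate_mono h3 T).trans ?_
  rw [rate_natCast hpos, EReal.coe_le_coe_iff, div_le_iff₀ (by exact_mod_cast hT0)]
  push_cast
  rw [Real.log_mul (by positivity) (by positivity), Real.log_pow]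
  linarith

/-- A totally bounded dynamical system whose separation and spanning numbers oscillate yields, by
completion, a compact system with oscillating Bowen growth rates and finite entropy. -/
theorem exists_compact_system [Nonempty Y] {b : ℕ} (hb : 1 ≤ b)
    (hspan : ∀ ε > 0, ∃ C : ℕ, 1 ≤ C ∧ ∀ T, ∃ A : Finset Y, A.card ≤ C * b ^ T ∧
      ∀ y, ∃ a ∈ A, ∀ t < T, dist (F^[t] a) (F^[t] y) < ε)
    {c c' : ℝ} (hcc : c < c')
    (hlow : ∃ᶠ T : ℕ in atTop, ∃ δ > 0, δ < 1 ∧ ∃ K : ℕ, 1 ≤ K ∧ Real.log K ≤ c * T ∧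
      ∀ A : Finset Y, (∀ x ∈ A, ∀ y ∈ A, x ≠ y →
        ∃ t < T, 1 - δ < dist (F^[t] x) (F^[t] y)) → A.card ≤ K)
    (hhigh : ∃ᶠ T : ℕ in atTop, ∃ S : Finset Y, 1 ≤ S.card ∧ c' * T ≤ Real.log S.card ∧
      ∀ u ∈ S, ∀ v ∈ S, ∀ a, (∀ t < T, dist (F^[t] a) (F^[t] u) < 1) →
        (∀ t < T, dist (F^[t] a) (F^[t] v) < 1) → u = v) :
    ∃ (X : Type) (_ : MetricSpace X) (_ : CompactSpace X) (F : X ≃ₜ X),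
      (∃ ε : ℝ, 0 < ε ∧
        liminf (fun T : ℕ =>
            BowenEntropy.rate (BowenEntropy.spanNum (BowenEntropy.dynDist F T) ε) T) atTop <
          limsup (fun T : ℕ =>
            BowenEntropy.rate (BowenEntropy.spanNum (BowenEntropy.dynDist F T) ε) T) atTop ∧
        liminf (fun T : ℕ =>
            BowenEntropy.rate (BowenEntropy.sepNum (BowenEntropy.dynDist F T) ε) T) atTop <
          limsup (fun T : ℕ =>
            BowenEntropy.rate (BowenEntropy.sepNum (BowenEntropy.dynDist F T) ε) T) atTop) ∧
      ∃ h : ℝ,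
        Tendsto (fun ε : ℝ => limsup (fun T : ℕ =>
            BowenEntropy.rate (BowenEntropy.covNum (BowenEntropy.dynDist F T) ε) T) atTop)
          (𝓝[>] 0) (𝓝 (h : EReal)) ∧
        Tendsto (fun ε : ℝ => limsup (fun T : ℕ =>
            BowenEntropy.rate (BowenEntropy.sepNum (BowenEntropy.dynDist F T) ε) T) atTop)
          (𝓝[>] 0) (𝓝 (h : EReal)) ∧
        Tendsto (fun ε : ℝ => limsup (fun T : ℕ =>
            BowenEntropy.rate (BowenEntropy.spanNum (BowenEntropy.dynDist F T) ε) T) atTop)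
          (𝓝[>] 0) (𝓝 (h : EReal)) := by
  have htb : TotallyBounded (Set.univ : Set Y) := by
    refine Metric.totallyBounded_iff.2 fun ε hε => ?_
    obtain ⟨C, _, h⟩ := hspan ε hε
    obtain ⟨A, _, hA⟩ := h 1
    refine ⟨A, A.finite_toSet, fun y _ => ?_⟩
    obtain ⟨a, ha, hay⟩ := hA y
    have := hay 0 one_pos
    simp only [Function.iterate_zero, id] at this
    exact Set.mem_biUnion ha (Metric.mem_ball'.2 this)
  have : Nonempty (Completion Y) := Nonempty.map (↑) ‹Nonempty Y›
  set G := Completion.mapEquiv F with hG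
  have hss : ∀ T, spanNum (dynDist G T) 1 ≤ sepNum (dynDist G T) 1 := fun T =>
    spanNum_le_sepNum (fun x => by rw [dynDist_self]; exact one_pos) (dynDist_comm _ T)
  have hsep_low : ∃ᶠ T : ℕ in atTop, rate (sepNum (dynDist G T) 1) T ≤ (c : EReal) := by
    refine (hlow.and_eventually (eventually_gt_atTop 0)).mono ?_
    rintro T ⟨⟨δ, hδ, hδ1, K, hK1, hK, h⟩, hT⟩
    refine (rate_mono (sepNum_mapEquiv_le F hδ hδ1 h) T).trans ?_
    rw [rate_natCast hK1, EReal.coe_le_coe_iff, div_le_iff₀ (by exact_mod_cast hT)]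
    exact hK
  have hspan_high : ∃ᶠ T : ℕ in atTop, (c' : EReal) ≤ rate (spanNum (dynDist G T) 1) T := by
    refine (hhigh.and_eventually (eventually_gt_atTop 0)).mono ?_
    rintro T ⟨⟨S, hS1, hS, h⟩, hT⟩
    refine le_trans ?_ (rate_mono (le_spanNum_mapEquiv F h) T)
    rw [rate_natCast hS1, EReal.coe_le_coe_iff, le_div_iff₀ (by exact_mod_cast hT)]
    exact hS
  have hccE : (c : EReal) < c' := EReal.coe_lt_coe_iff.2 hcc
  refine ⟨Completion Y, inferInstance, compactSpace_completion htb, G.toHomeomorph,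
    ⟨1, one_pos, ?_, ?_⟩, ?_⟩
  · exact (liminf_le_of_frequently_le' (hsep_low.mono fun T h =>
      (rate_mono (hss T) T).trans h)).trans_lt (hccE.trans_le
      (le_limsup_of_frequently_le' hspan_high))
  · exact (liminf_le_of_frequently_le' hsep_low).trans_lt (hccE.trans_le
      (le_limsup_of_frequently_le' (hspan_high.mono fun T h => h.trans (rate_mono (hss T) T))))
  · exact exists_entropy G (Real.log b + 1) fun ε hε => limsup_covNum_mapEquiv_le F hb hspan hε

end

/-! ### Redundant codes and random colourings of pairs. -/

/-- A block code with `k + 2` letters over an alphabet of size `N`: the first letter is constant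
and any two distinct words differ in at least two letters. -/
theorem exists_code (N k : ℕ) [NeZero N] : ∃ b : Fin (N ^ k) → ℕ → Fin N,
    (∀ U, b U 0 = 0) ∧ ∀ U V, U ≠ V → ∃ i j, i < k + 2 ∧ j < k + 2 ∧ i ≠ j ∧
      b U i ≠ b V i ∧ b U j ≠ b V j := by
  classical
  have e : Fin (N ^ k) ≃ (Fin k → Fin N) := Fintype.equivOfCardEq (by simp)
  -- Letters `1, …, k` are free and letter `k + 1` is their sum modulo `N`: a change in exactly one
  -- free letter also changes the sum.
  refine ⟨fun U i => if h : 1 ≤ i ∧ i < k + 1 then e U ⟨i - 1, by omega⟩ else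
    if i = k + 1 then ∑ l, e U l else 0, fun U => by simp, fun U V hUV => ?_⟩
  have hne : e U ≠ e V := fun h => hUV (e.injective h)
  obtain ⟨i, hi⟩ := Function.ne_iff.1 hne
  by_cases hsum : ∑ l, e U l = ∑ l, e V l
  · obtain ⟨j, hji, hj⟩ : ∃ j, j ≠ i ∧ e U j ≠ e V j := by
      by_contra! hall
      apply hi
      rw [← Finset.add_sum_erase _ _ (Finset.mem_univ i),
        ← Finset.add_sum_erase _ _ (Finset.mem_univ i)] at hsum
      rw [Finset.sum_congr rfl fun j hj => hall j (Finset.ne_of_mem_erase hj)] at hsum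
      exact add_right_cancel hsum
    refine ⟨i + 1, j + 1, by omega, by omega, ?_, ?_, ?_⟩
    · intro h
      exact hji (Fin.ext (by omega))
    · simpa using hi
    · simpa using hj
  · refine ⟨i + 1, k + 1, by omega, by omega, by omega, ?_, ?_⟩
    · simpa using hi
    · simpa using hsum

/-- Two-valued functions with prescribed values on `Q`. -/
theorem card_filter_eqOn {P : Type*} [Fintype P] [DecidableEq P] (Q : Finset P) (g : P → Bool) :
    (Finset.univ.filter fun w : P → Bool => ∀ p ∈ Q, w p = g p).card * 2 ^ Q.card =
      2 ^ Fintype.card P := by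
  have h1 : (Finset.univ.filter fun w : P → Bool => ∀ p ∈ Q, w p = g p) =
      Fintype.piFinset fun p => if p ∈ Q then {g p} else Finset.univ := by
    ext w
    simp only [Finset.mem_filter, Finset.mem_univ, true_and, Fintype.mem_piFinset]
    refine forall_congr' fun p => ?_
    by_cases hp : p ∈ Q <;> simp [hp]
  rw [h1, Fintype.card_piFinset]
  have h2 : ∀ p, (if p ∈ Q then ({g p} : Finset Bool) else Finset.univ).card =
      if p ∈ Q then 1 else 2 := fun p => by
    split_ifs <;> simp
  simp only [h2]
  have h3 : (2 : ℕ) ^ Q.card = ∏ p, if p ∈ Q then 2 else 1 := by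
    rw [Finset.prod_ite]
    simp
  rw [h3, ← Finset.prod_mul_distrib]
  have h4 : ∀ p : P, ((if p ∈ Q then 1 else 2) * if p ∈ Q then 2 else 1) = 2 := fun p => by
    split_ifs <;> rfl
  simp [h4]

/-- The numerical core of the union bound: `s.choose 2 = s * (s - 1) / 2` is at least `s * (e + 1)`.
-/
theorem pairs_gt {e s q : ℕ} (hs : 2 * e + 3 ≤ s) (hq : q < 2 ^ s) :
    (2 ^ e) ^ s * q < 2 ^ s.choose 2 := by
  have h1 : e * s + s ≤ s.choose 2 := by
    rw [Nat.choose_two_right, Nat.le_div_iff_mul_le two_pos]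
    obtain ⟨r, rfl⟩ := Nat.exists_eq_add_of_le hs
    have : 2 * e + 3 + r - 1 = 2 * e + 2 + r := by omega
    rw [this]
    nlinarith [Nat.zero_le (r * (2 * e + 3 + r))]
  calc (2 ^ e) ^ s * q < (2 ^ e) ^ s * 2 ^ s :=
        Nat.mul_lt_mul_of_pos_left hq (by positivity)
    _ = 2 ^ (e * s + s) := by rw [← pow_mul, ← pow_add]
    _ ≤ 2 ^ s.choose 2 := Nat.pow_le_pow_right two_pos h1

/-- If every pair of distinct vertices has two admissible colours, there is an admissible
colouring of the pairs without large monochromatic cliques. -/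
theorem exists_coloring {V : Type*} [Fintype V] [DecidableEq V] {q s e : ℕ}
    (D : V → V → ℕ → Prop) (hDs : ∀ u v i, D u v i → D v u i)
    (hD : ∀ u v, u ≠ v → ∃ i j, i < q ∧ j < q ∧ i ≠ j ∧ D u v i ∧ D u v j)
    (hV : Fintype.card V ≤ 2 ^ e) (hs : 2 * e + 3 ≤ s) (hq : q < 2 ^ s) :
    ∃ κ : V → V → ℕ, (∀ u v, κ u v = κ v u) ∧ (∀ u v, u ≠ v → κ u v < q ∧ D u v (κ u v)) ∧
      ∀ j, ∀ S : Finset V, (∀ u ∈ S, ∀ v ∈ S, u ≠ v → κ u v = j) → S.card < s := by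
  classical
  have hchoice : ∀ p : Sym2 V, ∃ i j : ℕ, i ≠ j ∧ ∀ u v, p = s(u, v) → u ≠ v →
      i < q ∧ j < q ∧ D u v i ∧ D u v j := by
    intro p
    induction p using Sym2.ind with
    | _ u v =>
      by_cases huv : u = v
      · refine ⟨0, 1, by omega, fun u' v' h hne => absurd ?_ hne⟩
        subst huv
        have := Sym2.eq_iff.1 h
        rcases this with ⟨rfl, rfl⟩ | ⟨rfl, rfl⟩ <;> rfl
      · obtain ⟨i, j, hi, hj, hij, hDi, hDj⟩ := hD u v huv
        refine ⟨i, j, hij, fun u' v' h _ => ?_⟩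
        rcases Sym2.eq_iff.1 h with ⟨rfl, rfl⟩ | ⟨rfl, rfl⟩
        · exact ⟨hi, hj, hDi, hDj⟩
        · exact ⟨hi, hj, hDs _ _ _ hDi, hDs _ _ _ hDj⟩
  choose α β hαβ hprop using hchoice
  -- A bit for each pair selects one of its two candidate colours; `bad` collects the selections for
  -- which a given `s`-set is monochromatic in a given colour.
  let col : (Sym2 V → Bool) → Sym2 V → ℕ := fun w p => if w p then α p else β p
  let bad : Finset V × ℕ → Finset (Sym2 V → Bool) := fun x =>
    Finset.univ.filter fun w => ∀ p ∈ x.1.offDiag.image Sym2.mk.uncurry, col w p = x.2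
  let I : Finset (Finset V × ℕ) := (Finset.univ.powersetCard s) ×ˢ Finset.range q
  have hbad : ∀ x ∈ I, (bad x).card * 2 ^ s.choose 2 ≤ 2 ^ Fintype.card (Sym2 V) := by
    intro x hx
    have hx1 : x.1.card = s := (Finset.mem_powersetCard.1 (Finset.mem_product.1 hx).1).2
    -- Since `α p ≠ β p`, a prescribed colour leaves at most one value for the bit at each of the
    -- `s.choose 2` pairs.
    rw [← card_filter_eqOn (x.1.offDiag.image Sym2.mk.uncurry) (fun p => decide (α p = x.2))]
    have hc : (x.1.offDiag.image Sym2.mk.uncurry).card = s.choose 2 := by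
      rw [← hx1]
      exact Sym2.card_image_offDiag x.1
    rw [hc]
    refine Nat.mul_le_mul_right _ (Finset.card_le_card ?_)
    intro w hw
    simp only [bad, Finset.mem_filter, Finset.mem_univ, true_and] at hw ⊢
    intro p hp
    have h1 := hw p hp
    have h2 := hαβ p
    simp only [col] at h1
    by_cases hwp : w p = true
    · simp only [hwp, if_true] at h1 ⊢
      simp [h1]
    · simp only [hwp] at h1 ⊢
      have h3 : α p ≠ x.2 := fun h => h2 (by rw [h, ← h1]; simp)
      simp [h3]
  have hI : I.card ≤ (2 ^ e) ^ s * q := by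
    rw [Finset.card_product, Finset.card_powersetCard, Finset.card_range, Finset.card_univ]
    refine Nat.mul_le_mul_right _ ((Nat.choose_le_pow _ _).trans ?_)
    exact Nat.pow_le_pow_left hV s
  have hunion : (I.biUnion bad).card < 2 ^ Fintype.card (Sym2 V) := by
    have h1 : (I.biUnion bad).card * 2 ^ s.choose 2 ≤
        I.card * 2 ^ Fintype.card (Sym2 V) := by
      calc _ ≤ (∑ x ∈ I, (bad x).card) * 2 ^ s.choose 2 :=
            Nat.mul_le_mul_right _ Finset.card_biUnion_le
        _ = ∑ x ∈ I, (bad x).card * 2 ^ s.choose 2 := Finset.sum_mul _ _ _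
        _ ≤ I.card • 2 ^ Fintype.card (Sym2 V) := Finset.sum_le_card_nsmul _ _ _ hbad
        _ = _ := by rw [smul_eq_mul]
    have h2 : I.card < 2 ^ s.choose 2 := hI.trans_lt (pairs_gt hs hq)
    by_contra! h3
    have h4 : I.card * 2 ^ Fintype.card (Sym2 V) <
        2 ^ s.choose 2 * 2 ^ Fintype.card (Sym2 V) :=
      Nat.mul_lt_mul_of_pos_right h2 (by positivity)
    have h5 := Nat.mul_le_mul_right (2 ^ s.choose 2) h3
    rw [mul_comm (2 ^ s.choose 2)] at h4
    omega
  obtain ⟨w, hw⟩ : ∃ w, w ∉ I.biUnion bad := by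
    by_contra! hall
    rw [Finset.eq_univ_of_forall hall, Finset.card_univ] at hunion
    simp at hunion
  have hcol : ∀ u v, u ≠ v → col w s(u, v) < q ∧ D u v (col w s(u, v)) := by
    intro u v huv
    obtain ⟨h1, h2, h3, h4⟩ := hprop _ u v rfl huv
    by_cases hwp : w s(u, v) = true
    · simp only [col, hwp, if_true]
      exact ⟨h1, h3⟩
    · simp only [col, hwp]
      exact ⟨h2, h4⟩
  refine ⟨fun u v => col w s(u, v), fun u v => by simp only [Sym2.eq_swap], hcol, ?_⟩
  intro j S hS
  by_contra! hcard
  obtain ⟨S', hS', hcard'⟩ := Finset.exists_subset_card_eq hcard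
  have hj : j < q := by
    have : 1 < S'.card := by omega
    obtain ⟨u, hu, v, hv, huv⟩ := Finset.one_lt_card.1 this
    rw [← hS u (hS' hu) v (hS' hv) huv]
    exact (hcol u v huv).1
  refine hw (Finset.mem_biUnion.2 ⟨(S', j), ?_, ?_⟩)
  · simp [I, hcard', hj]
  · simp only [bad, Finset.mem_filter, Finset.mem_univ, true_and, Finset.mem_image,
      Finset.mem_offDiag]
    rintro p ⟨⟨u, v⟩, ⟨hu, hv, huv⟩, rfl⟩
    exact hS u (hS' hu) v (hS' hv) huv

/-- Block code together with a colouring of pairs of words by a block in which they differ,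
such that there are no large monochromatic cliques. -/
theorem exists_level {N k e s : ℕ} (hN : 0 < N) (hNe : N ^ k ≤ 2 ^ e) (hs : 2 * e + 3 ≤ s)
    (hk : k + 2 < 2 ^ s) :
    ∃ b κ : ℕ → ℕ → ℕ, (∀ u j, b u j < N) ∧ (∀ u, b u 0 = 0) ∧ (∀ u v, κ u v = κ v u) ∧
      (∀ u v, u < N ^ k → v < N ^ k → u ≠ v →
        κ u v < k + 2 ∧ b u (κ u v) ≠ b v (κ u v)) ∧
      ∀ j, ∀ S : Finset ℕ, (∀ u ∈ S, u < N ^ k) →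
        (∀ u ∈ S, ∀ v ∈ S, u ≠ v → κ u v = j) → S.card < s := by
  have : NeZero N := ⟨hN.ne'⟩
  have hNk : 0 < N ^ k := by positivity
  have : NeZero (N ^ k) := ⟨hNk.ne'⟩
  obtain ⟨b, hb0, hb⟩ := exists_code N k
  obtain ⟨κ, hκs, hκ, hclique⟩ := exists_coloring (q := k + 2) (s := s) (e := e)
    (fun u v i => b u i ≠ b v i) (fun u v i h => h.symm) hb (by simpa using hNe) hs hk
  refine ⟨fun u j => b (Fin.ofNat (N ^ k) u) j,
    fun u v => κ (Fin.ofNat (N ^ k) u) (Fin.ofNat (N ^ k) v), fun u j => Fin.is_lt _,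
    fun u => by simp [hb0], fun u v => hκs _ _, ?_, ?_⟩
  · intro u v hu hv huv
    have hne : Fin.ofNat (N ^ k) u ≠ Fin.ofNat (N ^ k) v := by
      intro h
      have := congrArg Fin.val h
      simp only [Fin.ofNat, Nat.mod_eq_of_lt hu, Nat.mod_eq_of_lt hv] at this
      exact huv this
    obtain ⟨h1, h2⟩ := hκ _ _ hne
    exact ⟨h1, fun h => h2 (Fin.ext h)⟩
  · intro j S hSlt hS
    have hinj : Set.InjOn (Fin.ofNat (N ^ k)) S := by
      intro u hu v hv h
      have := congrArg Fin.val h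
      simpa only [Fin.ofNat, Nat.mod_eq_of_lt (hSlt u hu), Nat.mod_eq_of_lt (hSlt v hv)] using this
    rw [← Finset.card_image_of_injOn hinj]
    refine hclique j _ ?_
    intro u hu v hv huv
    obtain ⟨u, hu', rfl⟩ := Finset.mem_image.1 hu
    obtain ⟨v, hv', rfl⟩ := Finset.mem_image.1 hv
    exact hS u hu' v hv' fun h => huv (h ▸ rfl)

/-! ### Weighted sums normalised to maximum 1. -/

section weightedSum

/-- The sum of `f` with the weights `1/4, 1/8, 1/16, …`. -/
noncomputable def weightedSum (f : ℕ → ℝ) : ℝ := ∑' m, (1 / 2 : ℝ) ^ (m + 2) * f m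

variable {f g : ℕ → ℝ}

theorem hasSum_weights : HasSum (fun m : ℕ => (1 / 2 : ℝ) ^ (m + 2) * 2) 1 := by
  have := hasSum_geometric_two.mul_left (1 / 2 : ℝ)
  norm_num at this
  refine this.congr_fun fun m => ?_
  ring

theorem summable_weighted (h0 : ∀ m, 0 ≤ f m) (h2 : ∀ m, f m ≤ 2) :
    Summable fun m : ℕ => (1 / 2 : ℝ) ^ (m + 2) * f m :=
  Summable.of_nonneg_of_le (fun m => mul_nonneg (by positivity) (h0 m))
    (fun m => mul_le_mul_of_nonneg_left (h2 m) (by positivity)) hasSum_weights.summable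

theorem le_weightedSum (h0 : ∀ m, 0 ≤ f m) (h2 : ∀ m, f m ≤ 2) (m : ℕ) :
    (1 / 2 : ℝ) ^ (m + 2) * f m ≤ weightedSum f :=
  (summable_weighted h0 h2).le_tsum m fun k _ => mul_nonneg (by positivity) (h0 k)

/-- The weights times 2 sum to 1, so any deficit of a single term from 2 is lost from the total. -/
theorem weightedSum_add_le (h0 : ∀ m, 0 ≤ f m) (h2 : ∀ m, f m ≤ 2) (m : ℕ) :
    weightedSum f + (1 / 2 : ℝ) ^ (m + 2) * (2 - f m) ≤ 1 := by
  have h := hasSum_weights.sub (summable_weighted h0 h2).hasSum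
  have h1 := le_hasSum h m fun k _ => by
    rw [← mul_sub]
    exact mul_nonneg (by positivity) (sub_nonneg.2 (h2 k))
  rw [← mul_sub] at h1
  unfold weightedSum
  linarith

theorem weightedSum_le_of_eq_zero (h0 : ∀ m, 0 ≤ f m) (h2 : ∀ m, f m ≤ 2) {M : ℕ}
    (hM : ∀ m ≤ M, f m = 0) : weightedSum f ≤ (1 / 2 : ℝ) ^ (M + 1) := by
  unfold weightedSum
  rw [← (summable_weighted h0 h2).sum_add_tsum_nat_add (M + 1)]
  rw [Finset.sum_eq_zero fun m hm => by
    rw [hM m (by have := Finset.mem_range.1 hm; omega), mul_zero], zero_add]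
  have h := hasSum_weights.mul_left ((1 / 2 : ℝ) ^ (M + 1))
  rw [mul_one] at h
  refine h.tsum_eq ▸ Summable.tsum_le_tsum (fun m => ?_) ?_ h.summable
  · calc (1 / 2 : ℝ) ^ (m + (M + 1) + 2) * f (m + (M + 1))
        ≤ (1 / 2 : ℝ) ^ (m + (M + 1) + 2) * 2 :=
          mul_le_mul_of_nonneg_left (h2 _) (by positivity)
      _ = _ := by ring
  · exact (summable_nat_add_iff (M + 1)).2 (summable_weighted h0 h2)

end weightedSum

/-! ### Lengths and numbers of words. -/

/-- The number of blocks of level `m` in a block of level `m + 1`. -/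
def numBlocks (m : ℕ) : ℕ := 2 ^ (m + 3)

/-- The length of a block of level `m`. -/
def len : ℕ → ℕ
  | 0 => 1
  | m + 1 => numBlocks m * len m

/-- The binary logarithm of the number of words of level `m`. -/
def expo : ℕ → ℕ
  | 0 => 1
  | m + 1 => (numBlocks m - 2) * expo m

/-- The number of words of level `m`. -/
def numWords (m : ℕ) : ℕ := 2 ^ expo m

theorem numBlocks_ge (m : ℕ) : 8 ≤ numBlocks m := by
  unfold numBlocks
  calc 8 = 2 ^ 3 := rfl
    _ ≤ 2 ^ (m + 3) := Nat.pow_le_pow_right two_pos (by omega)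

theorem len_pos (m : ℕ) : 0 < len m := by
  induction m with
  | zero => exact Nat.one_pos
  | succ m ih => exact Nat.mul_pos (by have := numBlocks_ge m; omega) ih

instance (m : ℕ) : NeZero (len m) := ⟨(len_pos m).ne'⟩

theorem len_succ (m : ℕ) : len (m + 1) = numBlocks m * len m := rfl

theorem len_lt_succ (m : ℕ) : len m < len (m + 1) := by
  rw [len_succ]
  nlinarith [numBlocks_ge m, len_pos m]

theorem len_strictMono : StrictMono len := strictMono_nat_of_lt_succ len_lt_succ

theorem lt_len (m : ℕ) : m < len m := by
  induction m with
  | zero => exact Nat.one_pos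
  | succ m ih => have := len_lt_succ m; omega

theorem len_dvd {i j : ℕ} (h : i ≤ j) : len i ∣ len j := by
  induction j, h using Nat.le_induction with
  | base => exact dvd_rfl
  | succ j _ ih => exact ih.trans (Dvd.intro_left _ rfl)

theorem expo_le_len (m : ℕ) : expo m ≤ len m := by
  induction m with
  | zero => exact le_rfl
  | succ m ih => exact Nat.mul_le_mul (Nat.sub_le _ _) ih

/-- The ratio `expo m / len m` is a product of factors `1 - 2 ^ (-(i + 2))`, which stays above `1 /
2`. The induction carries the stronger bound `1 / 2 + 2 ^ (-(m + 1))`. -/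
theorem len_le_two_mul_expo (m : ℕ) : len m ≤ 2 * expo m := by
  have key : (2 ^ m + 1) * len m ≤ 2 ^ (m + 1) * expo m := by
    induction m with
    | zero => simp [len, expo]
    | succ m ih =>
      have h8 := numBlocks_ge m
      obtain ⟨k, hk⟩ : ∃ k, numBlocks m = k + 2 := ⟨numBlocks m - 2, by omega⟩
      have hk' : k + 2 = 8 * 2 ^ m := by rw [← hk]; unfold numBlocks; ring
      simp only [len, expo, hk, Nat.add_sub_cancel]
      have h1 := Nat.mul_le_mul_left k (Nat.mul_le_mul_left 2 ih)
      have h2 : (2 ^ (m + 1) + 1) * (k + 2) ≤ 2 * k * (2 ^ m + 1) := by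
        have h3 : 1 ≤ 2 ^ m := Nat.one_le_two_pow
        rw [pow_succ]
        nlinarith
      calc (2 ^ (m + 1) + 1) * ((k + 2) * len m)
          = ((2 ^ (m + 1) + 1) * (k + 2)) * len m := by ring
        _ ≤ (2 * k * (2 ^ m + 1)) * len m := Nat.mul_le_mul_right _ h2
        _ = k * (2 * ((2 ^ m + 1) * len m)) := by ring
        _ ≤ k * (2 * (2 ^ (m + 1) * expo m)) := h1
        _ = _ := by ring
  have h : 2 ^ m * len m ≤ 2 ^ m * (2 * expo m) := by
    calc 2 ^ m * len m ≤ (2 ^ m + 1) * len m := Nat.mul_le_mul_right _ (Nat.le_succ _)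
      _ ≤ _ := key
      _ = _ := by ring
  exact Nat.le_of_mul_le_mul_left h (by positivity)

/-! ### Hierarchical words and their distinguishing positions. -/

/-- Hierarchical block structure: `b m u j` is the `j`-th block (of level `m`) of the word `u` of
level `m + 1`, and `κ m u v` is a block in which the distinct words `u` and `v` differ. -/
structure BlockSystem where
  b : ℕ → ℕ → ℕ → ℕ
  κ : ℕ → ℕ → ℕ → ℕ
  b_lt : ∀ m u j, b m u j < numWords m
  b_zero : ∀ m u, b m u 0 = 0
  κ_comm : ∀ m u v, κ m u v = κ m v u
  κ_lt : ∀ m u v, u < numWords (m + 1) → v < numWords (m + 1) → u ≠ v → κ m u v < numBlocks m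
  b_κ_ne : ∀ m u v, u < numWords (m + 1) → v < numWords (m + 1) → u ≠ v →
    b m u (κ m u v) ≠ b m v (κ m u v)
  clique : ∀ m j, ∀ S : Finset ℕ, (∀ u ∈ S, u < numWords (m + 1)) →
    (∀ u ∈ S, ∀ v ∈ S, u ≠ v → κ m u v = j) → S.card < 2 * expo (m + 1) + 3

theorem nonempty_blockSystem : Nonempty BlockSystem := by
  have h : ∀ m, ∃ b κ : ℕ → ℕ → ℕ, (∀ u j, b u j < numWords m) ∧ (∀ u, b u 0 = 0) ∧
      (∀ u v, κ u v = κ v u) ∧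
      (∀ u v, u < numWords (m + 1) → v < numWords (m + 1) → u ≠ v →
        κ u v < numBlocks m ∧ b u (κ u v) ≠ b v (κ u v)) ∧
      ∀ j, ∀ S : Finset ℕ, (∀ u ∈ S, u < numWords (m + 1)) →
        (∀ u ∈ S, ∀ v ∈ S, u ≠ v → κ u v = j) → S.card < 2 * expo (m + 1) + 3 := by
    intro m
    obtain ⟨k, hk⟩ : ∃ k, numBlocks m = k + 2 :=
      ⟨numBlocks m - 2, by have := numBlocks_ge m; omega⟩
    have hN : numWords (m + 1) = numWords m ^ k := by
      simp only [numWords, expo, hk, Nat.add_sub_cancel, ← pow_mul]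
      rw [mul_comm]
    rw [hN, hk]
    refine exists_level (by unfold numWords; positivity) ?_ le_rfl ?_
    · rw [← hN]; exact le_rfl
    · rw [← hk]
      refine Nat.pow_lt_pow_right one_lt_two ?_
      have h1 := len_le_two_mul_expo (m + 1)
      have h2 := lt_len (m + 1)
      omega
  choose b κ h1 h2 h3 h4 h5 using h
  exact ⟨⟨b, κ, h1, h2, h3, fun m u v hu hv huv => (h4 m u v hu hv huv).1,
    fun m u v hu hv huv => (h4 m u v hu hv huv).2, h5⟩⟩

namespace BlockSystem

variable (B : BlockSystem)

/-- The word of level `m` at position `p` of the word `u` of level `m + d`. -/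
def word (m : ℕ) : ℕ → ℕ → ℕ → ℕ
  | 0, u, _ => u
  | d + 1, u, p => word m d (B.b (m + d) u (p / len (m + d))) (p % len (m + d))

/-- Position `p` is the one at which the words `u` and `v` of level `m` are distinguished. -/
def FarAt : ℕ → ℕ → ℕ → ℕ → Prop
  | 0, u, v, _ => u ≠ v
  | m + 1, u, v, p => p / len m = B.κ m u v ∧
      FarAt m (B.b m u (p / len m)) (B.b m v (p / len m)) (p % len m)

theorem word_lt (m d : ℕ) {u : ℕ} (hu : u < numWords (m + d)) (p : ℕ) :
    B.word m d u p < numWords m := by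
  induction d generalizing u p with
  | zero => exact hu
  | succ d ih => exact ih (B.b_lt _ _ _) _

/-- `word` unfolds from the top level downwards; this peels off the lowest level instead. -/
theorem word_succ (m d u : ℕ) {p : ℕ} (hp : p < len (m + 1 + d)) :
    B.word m (d + 1) u p = B.b m (B.word (m + 1) d u p) (p % len (m + 1) / len m) := by
  induction d generalizing u p with
  | zero => simp only [word, add_zero] at hp ⊢; rw [Nat.mod_eq_of_lt hp]
  | succ d ih =>
    rw [word]
    rw [show m + (d + 1) = m + 1 + d by omega]
    rw [ih _ (Nat.mod_lt _ (len_pos _)), word, Nat.mod_mod_of_dvd _ (len_dvd (by omega))]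

theorem farAt_irrefl (m u p : ℕ) : ¬ B.FarAt m u u p := by
  induction m generalizing u p with
  | zero => simp [FarAt]
  | succ m ih => exact fun h => ih _ _ h.2

theorem farAt_symm {m u v p : ℕ} (h : B.FarAt m u v p) : B.FarAt m v u p := by
  induction m generalizing u v p with
  | zero => exact Ne.symm h
  | succ m ih => exact ⟨by rw [h.1, B.κ_comm], ih h.2⟩

theorem exists_farAt (m : ℕ) {u v : ℕ} (hu : u < numWords m) (hv : v < numWords m)
    (huv : u ≠ v) : ∃ p < len m, B.FarAt m u v p := by
  induction m generalizing u v with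
  | zero => exact ⟨0, len_pos 0, huv⟩
  | succ m ih =>
    obtain ⟨p, hp, h⟩ := ih (B.b_lt m u (B.κ m u v)) (B.b_lt m v (B.κ m u v))
      (B.b_κ_ne m u v hu hv huv)
    have h1 : (B.κ m u v * len m + p) / len m = B.κ m u v := by
      rw [mul_comm, Nat.mul_add_div (len_pos m), Nat.div_eq_of_lt hp, add_zero]
    have h2 : (B.κ m u v * len m + p) % len m = p := by
      rw [mul_comm, Nat.mul_add_mod, Nat.mod_eq_of_lt hp]
    refine ⟨B.κ m u v * len m + p, ?_, h1, ?_⟩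
    · have := B.κ_lt m u v hu hv huv
      rw [len_succ]
      nlinarith
    · rw [h1, h2]; exact h

/-- Distinguishing positions are nested, so being distinguished at a high level is inherited by all
lower levels. -/
theorem farAt_word {m d u v p : ℕ} (hp : p < len (m + d)) (h : B.FarAt (m + d) u v p) :
    B.FarAt m (B.word m d u p) (B.word m d v p) (p % len m) := by
  induction d generalizing u v p with
  | zero => rw [Nat.mod_eq_of_lt (show p < len m from hp)]; exact h
  | succ d ih =>
    have h3 := ih (Nat.mod_lt _ (len_pos _)) h.2
    rw [Nat.mod_mod_of_dvd _ (len_dvd (Nat.le_add_right m d))] at h3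
    exact h3

theorem κ_pos {m u v : ℕ} (hu : u < numWords (m + 1)) (hv : v < numWords (m + 1))
    (huv : u ≠ v) : 0 < B.κ m u v := by
  rw [Nat.pos_iff_ne_zero]
  intro h
  have := B.b_κ_ne m u v hu hv huv
  rw [h, B.b_zero, B.b_zero] at this
  exact this rfl

/-- The distinguishing position avoids the constant initial blocks. -/
theorem len_le_of_farAt {m u v p : ℕ} (hu : u < numWords (m + 1)) (hv : v < numWords (m + 1))
    (h : B.FarAt (m + 1) u v p) : len m ≤ p := by
  have huv : u ≠ v := by
    rintro rfl
    exact B.farAt_irrefl _ _ _ h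
  have h1 := B.κ_pos hu hv huv
  rw [← h.1] at h1
  exact (Nat.div_pos_iff.1 h1).2

end BlockSystem

/-! ### The periodic points and the shift. -/

/-- Periodic points carrying a word of level `3 * j` and a clock. -/
structure Sys (B : BlockSystem) : Type where
  /-- A third of the level. -/
  idx : ℕ
  /-- The word. -/
  label : Fin (numWords (3 * idx))
  /-- The clock. -/
  clock : ZMod (len (3 * idx))

namespace Sys

variable {B : BlockSystem}

/-- The level of a periodic point. -/
def top (x : Sys B) : ℕ := 3 * x.idx

/-- The word of a periodic point. -/
def wd (x : Sys B) : ℕ := x.label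

/-- The clock of a periodic point. -/
def pos (x : Sys B) : ℕ := x.clock.val

theorem wd_lt (x : Sys B) : x.wd < numWords x.top := x.label.2

theorem pos_lt (x : Sys B) : x.pos < len x.top := ZMod.val_lt _

theorem ext_iff' {x y : Sys B} :
    x = y ↔ x.top = y.top ∧ x.wd = y.wd ∧ x.pos = y.pos := by
  refine ⟨fun h => by simp [h], fun ⟨h1, h2, h3⟩ => ?_⟩
  obtain ⟨j, u, p⟩ := x
  obtain ⟨j', u', p'⟩ := y
  obtain rfl : j = j' := by simp only [top] at h1; omega
  obtain rfl : u = u' := Fin.ext h2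
  obtain rfl : p = p' := ZMod.val_injective _ h3
  rfl

variable (B) in
/-- The shift advances the clock. -/
def shift : Equiv.Perm (Sys B) where
  toFun x := ⟨x.idx, x.label, x.clock + 1⟩
  invFun x := ⟨x.idx, x.label, x.clock - 1⟩
  left_inv x := by simp
  right_inv x := by simp

theorem shift_iterate (t j : ℕ) (u : Fin (numWords (3 * j))) (p : ZMod (len (3 * j))) :
    (shift B)^[t] ⟨j, u, p⟩ = ⟨j, u, p + t⟩ := by
  induction t generalizing p with
  | zero => simp
  | succ t ih =>
    rw [Function.iterate_succ_apply]
    have : shift B ⟨j, u, p⟩ = ⟨j, u, p + 1⟩ := rfl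
    rw [this, ih]
    push_cast
    rw [add_assoc, add_comm (1 : ZMod _)]

theorem top_iterate (t : ℕ) (x : Sys B) : ((shift B)^[t] x).top = x.top := by
  obtain ⟨j, u, p⟩ := x
  rw [shift_iterate]
  rfl

theorem wd_iterate (t : ℕ) (x : Sys B) : ((shift B)^[t] x).wd = x.wd := by
  obtain ⟨j, u, p⟩ := x
  rw [shift_iterate]
  rfl

theorem pos_iterate (t : ℕ) (x : Sys B) :
    ((shift B)^[t] x).pos = (x.pos + t) % len x.top := by
  obtain ⟨j, u, p⟩ := x
  rw [shift_iterate]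
  simp only [pos, top, ZMod.val_add, ZMod.val_natCast, Nat.add_mod_mod]

/-- The word of level `i` at the current position, and the position in it. -/
def view (i : ℕ) (x : Sys B) : Option (ℕ × ℕ) :=
  if i ≤ x.top then some (B.word i (x.top - i) x.wd x.pos, x.pos % len i) else none

theorem view_of_le {i : ℕ} {x : Sys B} (h : i ≤ x.top) :
    x.view i = some (B.word i (x.top - i) x.wd x.pos, x.pos % len i) := if_pos h

theorem view_of_lt {i : ℕ} {x : Sys B} (h : x.top < i) : x.view i = none :=
  if_neg (not_le.2 h)

theorem view_pred {i : ℕ} {x : Sys B} (h : i + 1 ≤ x.top) :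
    x.view i = (x.view (i + 1)).map fun w => (B.b i w.1 (w.2 / len i), w.2 % len i) := by
  rw [view_of_le h, view_of_le (by omega), Option.map_some]
  obtain ⟨d, hd⟩ := Nat.exists_eq_add_of_le h
  have h1 : x.top - i = d + 1 := by omega
  have h2 : x.top - (i + 1) = d := by omega
  rw [h1, h2, B.word_succ i d _ (hd ▸ x.pos_lt), Nat.mod_mod_of_dvd _ (len_dvd (Nat.le_succ i))]

theorem view_eq_of_le {i j : ℕ} {x y : Sys B} (hij : i ≤ j) (hx : j ≤ x.top) (hy : j ≤ y.top)
    (h : x.view j = y.view j) : x.view i = y.view i := by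
  induction j, hij using Nat.le_induction with
  | base => exact h
  | succ j _ ih =>
    exact ih (by omega) (by omega) (by rw [view_pred hx, view_pred hy, h])

/-- Two views are distinguished. -/
def ViewFar (B : BlockSystem) (i : ℕ) : Option (ℕ × ℕ) → Option (ℕ × ℕ) → Prop
  | none, none => True
  | some (u, p), some (v, p') => p = p' ∧ B.FarAt i u v p
  | _, _ => False

theorem viewFar_symm {i : ℕ} {a b : Option (ℕ × ℕ)} (h : ViewFar B i a b) :
    ViewFar B i b a := by
  rcases a with _ | ⟨u, p⟩ <;> rcases b with _ | ⟨v, p'⟩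
  · trivial
  · exact h
  · exact h
  · obtain ⟨rfl, h⟩ := h
    exact ⟨rfl, B.farAt_symm h⟩

/-! ### The metric. -/

/-- Agreement of the views of levels at most `m` and of the marks, at times in `[-m, m]`. -/
def Agree (m : ℕ) (x y : Sys B) : Prop :=
  ∀ i ≤ m, ∀ t : ℤ, |t| ≤ m → (((shift B) ^ t) x).view i = (((shift B) ^ t) y).view i ∧
    ((((shift B) ^ t) x).pos = 0 ↔ (((shift B) ^ t) y).pos = 0)

/-- Points are distinguished up to level `m` at the current time. -/
def Far (m : ℕ) (x y : Sys B) : Prop :=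
  ¬ (x.pos = 0 ↔ y.pos = 0) ∨ ∀ i ≤ m, ViewFar B i (x.view i) (y.view i)

theorem Agree.refl (m : ℕ) (x : Sys B) : Agree m x x := fun _ _ _ _ => ⟨rfl, Iff.rfl⟩

theorem Agree.symm {m : ℕ} {x y : Sys B} (h : Agree m x y) : Agree m y x :=
  fun i hi t ht => ⟨(h i hi t ht).1.symm, (h i hi t ht).2.symm⟩

theorem Agree.trans {m : ℕ} {x y z : Sys B} (h : Agree m x y) (h' : Agree m y z) :
    Agree m x z :=
  fun i hi t ht => ⟨(h i hi t ht).1.trans (h' i hi t ht).1,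
    (h i hi t ht).2.trans (h' i hi t ht).2⟩

theorem Agree.mono {m n : ℕ} (hmn : m ≤ n) {x y : Sys B} (h : Agree n x y) : Agree m x y :=
  fun i hi t ht => h i (hi.trans hmn) t (ht.trans (by exact_mod_cast hmn))

theorem Agree.view_eq {m i : ℕ} {x y : Sys B} (h : Agree m x y) (hi : i ≤ m) :
    x.view i = y.view i := by
  simpa using (h i hi 0 (by simp)).1

theorem Agree.mark_iff {m : ℕ} {x y : Sys B} (h : Agree m x y) : x.pos = 0 ↔ y.pos = 0 := by
  simpa using (h 0 (Nat.zero_le _) 0 (by simp)).2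

/-- The two-sided time window in `Agree` exists for this: a shift in either direction loses one
level, which makes it uniformly bicontinuous. -/
theorem Agree.zpow {m : ℕ} {x y : Sys B} (h : Agree (m + 1) x y) {s : ℤ} (hs : |s| ≤ 1) :
    Agree m (((shift B) ^ s) x) (((shift B) ^ s) y) := by
  intro i hi t ht
  rw [← Equiv.Perm.mul_apply, ← Equiv.Perm.mul_apply, ← zpow_add]
  refine h i (by omega) _ ((abs_add_le t s).trans ?_)
  push_cast
  exact add_le_add ht hs

theorem Far.symm {m : ℕ} {x y : Sys B} (h : Far m x y) : Far m y x := by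
  rcases h with h | h
  · exact Or.inl fun h' => h h'.symm
  · exact Or.inr fun i hi => viewFar_symm (h i hi)

theorem Far.congr_right {m : ℕ} {x y z : Sys B} (h : Far m x y) (hyz : Agree m y z) :
    Far m x z := by
  rcases h with h | h
  · exact Or.inl fun h' => h (h'.trans hyz.mark_iff.symm)
  · exact Or.inr fun i hi => hyz.view_eq hi ▸ h i hi

theorem Far.not_agree {m : ℕ} {x y : Sys B} (h : Far m x y) : ¬ Agree m x y := by
  intro h'
  rcases h with h | h
  · exact h h'.mark_iff
  · have h0 := h 0 (Nat.zero_le _)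
    rw [h'.view_eq (Nat.zero_le _), view_of_le (Nat.zero_le _)] at h0
    exact B.farAt_irrefl _ _ _ h0.2

open Classical in
/-- The distance of level `m`. -/
noncomputable def levelDist (m : ℕ) (x y : Sys B) : ℝ :=
  if Agree m x y then 0 else if Far m x y then 2 else 1

theorem levelDist_of_agree {m : ℕ} {x y : Sys B} (h : Agree m x y) : levelDist m x y = 0 :=
  if_pos h

theorem levelDist_of_far {m : ℕ} {x y : Sys B} (h : Far m x y) : levelDist m x y = 2 := by
  rw [levelDist, if_neg h.not_agree, if_pos h]

theorem levelDist_nonneg (x y : Sys B) (m : ℕ) : 0 ≤ levelDist m x y := by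
  unfold levelDist
  split_ifs <;> norm_num

theorem levelDist_le_two (x y : Sys B) (m : ℕ) : levelDist m x y ≤ 2 := by
  unfold levelDist
  split_ifs <;> norm_num

theorem one_le_levelDist {m : ℕ} {x y : Sys B} (h : ¬ Agree m x y) : 1 ≤ levelDist m x y := by
  unfold levelDist
  split_ifs <;> norm_num

theorem levelDist_le_one {m : ℕ} {x y : Sys B} (h : ¬ Far m x y) : levelDist m x y ≤ 1 := by
  unfold levelDist
  split_ifs <;> norm_num

theorem levelDist_comm (m : ℕ) (x y : Sys B) : levelDist m x y = levelDist m y x := by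
  unfold levelDist
  have h1 : Agree m x y ↔ Agree m y x := ⟨Agree.symm, Agree.symm⟩
  have h2 : Far m x y ↔ Far m y x := ⟨Far.symm, Far.symm⟩
  classical exact if_congr h1 rfl (if_congr h2 rfl rfl)

theorem levelDist_congr_right {m : ℕ} {x y z : Sys B} (h : Agree m y z) :
    levelDist m x y = levelDist m x z := by
  unfold levelDist
  have h1 : Agree m x y ↔ Agree m x z := ⟨fun h' => h'.trans h, fun h' => h'.trans h.symm⟩
  have h2 : Far m x y ↔ Far m x z := ⟨fun h' => h'.congr_right h, fun h' => h'.congr_right h.symm⟩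
  classical exact if_congr h1 rfl (if_congr h2 rfl rfl)

/-- `Agree m` is an equivalence relation that `Far m` respects, so the distance lives on its
classes; between distinct classes it is 1 or 2, and `2 ≤ 1 + 1`. -/
theorem levelDist_triangle (m : ℕ) (x y z : Sys B) :
    levelDist m x z ≤ levelDist m x y + levelDist m y z := by
  by_cases h1 : Agree m y z
  · rw [levelDist_congr_right h1]
    linarith [levelDist_nonneg y z m]
  by_cases h2 : Agree m x y
  · rw [levelDist_comm m x z, levelDist_comm m y z, levelDist_congr_right h2]
    linarith [levelDist_nonneg x y m]
  linarith [one_le_levelDist h1, one_le_levelDist h2, levelDist_le_two x z m]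

theorem eq_of_agree {x y : Sys B} (h : ∀ m, Agree m x y) : x = y := by
  have hle : ∀ {x y : Sys B}, (∀ m, Agree m x y) → y.top ≤ x.top := by
    intro x y h
    by_contra! hlt
    have := (h y.top).view_eq le_rfl
    rw [view_of_lt hlt, view_of_le le_rfl] at this
    exact Option.noConfusion rfl (heq_of_eq this)
  have htop : x.top = y.top := le_antisymm (hle fun m => (h m).symm) (hle h)
  have := (h y.top).view_eq le_rfl
  rw [view_of_le htop.ge, view_of_le le_rfl, htop, Nat.sub_self] at this
  simp only [Option.some.injEq, Prod.mk.injEq] at this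
  rw [Nat.mod_eq_of_lt (htop ▸ x.pos_lt), Nat.mod_eq_of_lt y.pos_lt] at this
  exact ext_iff'.2 ⟨htop, this.1, this.2⟩

noncomputable instance : MetricSpace (Sys B) where
  dist x y := weightedSum fun m => levelDist m x y
  dist_self x := by
    simp [weightedSum, levelDist_of_agree (Agree.refl _ x)]
  dist_comm x y := by simp only [levelDist_comm]
  dist_triangle x y z := by
    have hs : ∀ x y : Sys B, Summable fun m : ℕ => (1 / 2 : ℝ) ^ (m + 2) * levelDist m x y :=
      fun x y => summable_weighted (levelDist_nonneg x y) (levelDist_le_two x y)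
    simp only [weightedSum]
    rw [← (hs x y).tsum_add (hs y z)]
    refine (hs x z).tsum_le_tsum (fun m => ?_) ((hs x y).add (hs y z))
    rw [← mul_add]
    exact mul_le_mul_of_nonneg_left (levelDist_triangle m x y z) (by positivity)
  eq_of_dist_eq_zero := by
    intro x y h
    refine eq_of_agree fun m => ?_
    by_contra hm
    have h1 := le_weightedSum (levelDist_nonneg x y) (levelDist_le_two x y) m
    have h2 := one_le_levelDist hm
    have h3 : (0 : ℝ) < (1 / 2) ^ (m + 2) := by positivity
    change weightedSum (fun m => levelDist m x y) = 0 at h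
    rw [h] at h1
    nlinarith

theorem dist_def (x y : Sys B) : dist x y = weightedSum fun m => levelDist m x y := rfl

theorem dist_le_of_agree {M : ℕ} {x y : Sys B} (h : Agree M x y) :
    dist x y ≤ (1 / 2 : ℝ) ^ (M + 1) :=
  weightedSum_le_of_eq_zero (levelDist_nonneg x y) (levelDist_le_two x y)
    fun _ hm => levelDist_of_agree (h.mono hm)

theorem agree_of_dist_lt {m : ℕ} {x y : Sys B} (h : dist x y < (1 / 2 : ℝ) ^ (m + 2)) :
    Agree m x y := by
  by_contra hm
  have h1 := le_weightedSum (levelDist_nonneg x y) (levelDist_le_two x y) m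
  have h2 := one_le_levelDist hm
  have h3 : (0 : ℝ) < (1 / 2) ^ (m + 2) := by positivity
  rw [dist_def] at h
  nlinarith

/-- A level that is not far falls short of 2 by at least 1 and costs its whole weight. -/
theorem far_of_lt_dist {m : ℕ} {x y : Sys B} (h : 1 - (1 / 2 : ℝ) ^ (m + 2) < dist x y) :
    Far m x y := by
  by_contra hm
  have h1 := weightedSum_add_le (levelDist_nonneg x y) (levelDist_le_two x y) m
  have h2 := levelDist_le_one hm
  have h3 : (0 : ℝ) < (1 / 2) ^ (m + 2) := by positivity
  rw [dist_def] at h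
  nlinarith

theorem exists_not_far {x y : Sys B} (h : dist x y < 1) : ∃ m, ¬ Far m x y := by
  by_contra! hall
  have : dist x y = 1 := by
    rw [dist_def]
    refine Eq.trans ?_ hasSum_weights.tsum_eq
    exact tsum_congr fun m => congrArg _ (levelDist_of_far (hall m))
  linarith

theorem exists_agree_scale {ε : ℝ} (hε : 0 < ε) :
    ∃ M : ℕ, ∀ x y : Sys B, Agree M x y → dist x y < ε := by
  obtain ⟨M, hM⟩ := exists_pow_lt_of_lt_one hε (by norm_num : (1 / 2 : ℝ) < 1)
  refine ⟨M, fun x y h => (dist_le_of_agree h).trans_lt (lt_of_le_of_lt ?_ hM)⟩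
  exact pow_le_pow_of_le_one (by norm_num) (by norm_num) (Nat.le_succ M)

theorem uniformContinuous_zpow {s : ℤ} (hs : |s| ≤ 1) :
    UniformContinuous ((shift B) ^ s : Equiv.Perm (Sys B)) := by
  refine Metric.uniformContinuous_iff.2 fun ε hε => ?_
  obtain ⟨M, hM⟩ := exists_agree_scale (B := B) hε
  exact ⟨(1 / 2 : ℝ) ^ (M + 1 + 2), by positivity, fun x y h =>
    hM _ _ ((agree_of_dist_lt h).zpow hs)⟩

variable (B) in
/-- The shift as a uniform isomorphism. -/
def shiftUniform : Sys B ≃ᵤ Sys B where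
  toEquiv := shift B
  uniformContinuous_toFun := by
    simpa using uniformContinuous_zpow (B := B) (s := 1) (by simp)
  uniformContinuous_invFun := by
    simpa using uniformContinuous_zpow (B := B) (s := -1) (by simp)

end Sys

/-! ### Nets of exponential size. -/

theorem exists_finset_of_code {Y α : Type*} [Fintype α] (f : Y → α) (P : Y → Prop) :
    ∃ A : Finset Y, A.card ≤ Fintype.card α ∧ ∀ y, P y → ∃ a ∈ A, P a ∧ f a = f y := by
  classical
  let I : Finset α := Finset.univ.filter fun c => ∃ y, P y ∧ f y = c
  have hI : ∀ c : I, ∃ y, P y ∧ f y = c := fun c =>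
    (Finset.mem_filter.1 c.2).2
  choose g hg using hI
  refine ⟨Finset.univ.image g, ?_, fun y hy => ?_⟩
  · refine Finset.card_image_le.trans ?_
    rw [Finset.card_univ, Fintype.card_coe]
    exact Finset.card_le_univ I
  · have hc : f y ∈ I := by simpa [I] using ⟨y, hy, rfl⟩
    exact ⟨_, Finset.mem_image_of_mem g (Finset.mem_univ ⟨f y, hc⟩), hg ⟨f y, hc⟩⟩

theorem div_eq_div_of_dvd {a b n n' : ℕ} (h : a / n = b / n) (hn : n ∣ n') :
    a / n' = b / n' := by
  obtain ⟨c, rfl⟩ := hn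
  rw [← Nat.div_div_eq_div_mul, ← Nat.div_div_eq_div_mul, h]

theorem mod_div_eq_of_dvd {a b n l : ℕ} (h : a / n = b / n) (hn : n ∣ l) :
    a % l / n = b % l / n := by
  obtain ⟨c, rfl⟩ := hn
  rw [Nat.mod_mul_right_div_self, Nat.mod_mul_right_div_self, h]

namespace BlockSystem

theorem word_congr (B : BlockSystem) (m d u : ℕ) {p p' : ℕ} (h : p / len m = p' / len m) :
    B.word m d u p = B.word m d u p' := by
  induction d generalizing u p p' with
  | zero => rfl
  | succ d ih =>
    have hd : len m ∣ len (m + d) := len_dvd (Nat.le_add_right m d)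
    rw [word, word, div_eq_div_of_dvd h hd]
    exact ih _ (mod_div_eq_of_dvd h hd)

end BlockSystem

namespace Sys

variable {B : BlockSystem}

/-- The points of level less than `3 * J`. -/
def small (B : BlockSystem) (J : ℕ) : Finset (Sys B) :=
  ((Finset.range J).sigma fun j =>
    (Finset.univ : Finset (Fin (numWords (3 * j)) × ZMod (len (3 * j))))).map
    ⟨fun s => ⟨s.1, s.2.1, s.2.2⟩, fun s s' h => by
      obtain ⟨j, u, p⟩ := s
      obtain ⟨j', u', p'⟩ := s'
      simp only [Sys.mk.injEq] at h
      obtain ⟨rfl, h1, h2⟩ := h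
      rw [eq_of_heq h1, eq_of_heq h2]⟩

theorem mem_small {J : ℕ} {x : Sys B} : x ∈ small B J ↔ x.idx < J := by
  simp only [small, Finset.mem_map, Finset.mem_sigma, Finset.mem_range, Finset.mem_univ, and_true]
  constructor
  · rintro ⟨s, hs, rfl⟩
    exact hs
  · exact fun h => ⟨⟨x.idx, x.label, x.clock⟩, h, rfl⟩

theorem card_small_succ_le (B : BlockSystem) (J : ℕ) :
    (small B (J + 1)).card ≤ (J + 1) * (numWords (3 * J) * len (3 * J)) := by
  rw [small, Finset.card_map, Finset.card_sigma]
  refine (Finset.sum_le_card_nsmul _ _ (numWords (3 * J) * len (3 * J)) ?_).trans ?_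
  · intro j hj
    have hj' : 3 * j ≤ 3 * J := by
      have := Finset.mem_range.1 hj
      omega
    rw [Finset.card_univ, Fintype.card_prod, Fintype.card_fin, ZMod.card]
    refine Nat.mul_le_mul (Nat.pow_le_pow_right two_pos ?_) (len_strictMono.monotone hj')
    refine monotone_nat_of_le_succ (fun m => ?_) hj'
    have := numBlocks_ge m
    exact Nat.le_mul_of_pos_left _ (by omega)
  · rw [Finset.card_range, smul_eq_mul]

theorem agree_of_iterates {m : ℕ} {x y : Sys B} {t : ℕ}
    (h : ∀ i ≤ m, ∀ s ≤ t + 2 * m,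
      ((shift B)^[s] x).view i = ((shift B)^[s] y).view i ∧
      (((shift B)^[s] x).pos = 0 ↔ ((shift B)^[s] y).pos = 0)) :
    Agree m ((shift B)^[t] ((shift B)^[m] x)) ((shift B)^[t] ((shift B)^[m] y)) := by
  intro i hi r hr
  obtain ⟨hr1, hr2⟩ := abs_le.1 hr
  obtain ⟨s, hs⟩ := Int.eq_ofNat_of_zero_le (show 0 ≤ r + t + m by omega)
  have key : ∀ z : Sys B, ((shift B) ^ r) ((shift B)^[t] ((shift B)^[m] z)) =
      (shift B)^[s] z := by
    intro z
    rw [← Function.iterate_add_apply, ← Equiv.Perm.coe_pow, ← Equiv.Perm.coe_pow,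
      ← zpow_natCast, ← zpow_natCast, ← Equiv.Perm.mul_apply, ← zpow_add]
    congr 2
    push_cast
    omega
  rw [key, key]
  exact h i hi s (by omega)

/-- The clock of level `M`, and the words of level `M` and marks of the blocks met at times up
to `k * len M`. -/
noncomputable def code (M K : ℕ) (x : Sys B) :
    Fin (len M) × (Fin K → Fin (numWords M) × Prop) :=
  (Fin.ofNat (len M) x.pos, fun k =>
    haveI : NeZero (numWords M) := ⟨by unfold numWords; positivity⟩
    (Fin.ofNat (numWords M)
      (B.word M (x.top - M) x.wd ((x.pos - x.pos % len M + k * len M) % len x.top)),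
      (x.pos - x.pos % len M + k * len M) % len x.top = 0))

/-- The position at time `s` is the start of its block of level `M` plus an offset. Reduction modulo
the period affects only the block start, because `len M` divides the period. -/
theorem pos_decomp {M : ℕ} {x : Sys B} (hx : M ≤ x.top) (s : ℕ) :
    (x.pos + s) % len x.top =
      (x.pos - x.pos % len M + (x.pos % len M + s) / len M * len M) % len x.top +
        (x.pos % len M + s) % len M := by
  have hM := len_pos M
  set l := len M with hl
  obtain ⟨c, hc⟩ : l ∣ len x.top := len_dvd hx
  have h1 : x.pos - x.pos % l = l * (x.pos / l) := by
    have := Nat.div_add_mod x.pos l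
    omega
  have h2 : x.pos + s = l * (x.pos / l + (x.pos % l + s) / l) + (x.pos % l + s) % l := by
    have := Nat.div_add_mod x.pos l
    have := Nat.div_add_mod (x.pos % l + s) l
    rw [mul_add]
    omega
  rw [h1, mul_comm _ l, ← mul_add, hc]
  nth_rewrite 1 [h2]
  rw [Nat.mul_mod_mul_left, Nat.mod_mul, Nat.mul_add_mod, Nat.mod_mod, Nat.mul_add_div hM,
    Nat.div_eq_of_lt (Nat.mod_lt _ hM), add_zero]
  ring

theorem obs_eq_of_code {M K : ℕ} {x y : Sys B} (hx : M ≤ x.top) (hy : M ≤ y.top)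
    (h : code M K x = code M K y) {s : ℕ} (hs : s < (K - 1) * len M) {i : ℕ} (hi : i ≤ M) :
    ((shift B)^[s] x).view i = ((shift B)^[s] y).view i ∧
      (((shift B)^[s] x).pos = 0 ↔ ((shift B)^[s] y).pos = 0) := by
  have hM := len_pos M
  obtain ⟨h1, h2⟩ := Prod.ext_iff.1 h
  have hclock : x.pos % len M = y.pos % len M := congrArg Fin.val h1
  have hk : (x.pos % len M + s) / len M < K := by
    rw [Nat.div_lt_iff_lt_mul hM]
    have := Nat.mod_lt x.pos hM
    obtain ⟨K', rfl⟩ : ∃ K', K = K' + 1 := ⟨K - 1, by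
      rcases K with _ | K
      · simp at hs
      · simp⟩
    simp only [Nat.add_sub_cancel] at hs
    nlinarith
  have h3 := congrFun h2 ⟨_, hk⟩
  simp only [code, Prod.mk.injEq, Fin.ofNat, Fin.mk.injEq] at h3
  obtain ⟨h3, h4⟩ := h3
  have hlt : ∀ {z : Sys B}, M ≤ z.top → ∀ p, B.word M (z.top - M) z.wd p < numWords M :=
    fun {z} hz p => B.word_lt M _ (by rw [Nat.add_sub_cancel' hz]; exact z.wd_lt) p
  rw [Nat.mod_eq_of_lt (hlt hx _), Nat.mod_eq_of_lt (hlt hy _)] at h3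
  have hdvd : ∀ {z : Sys B}, M ≤ z.top → ∀ k,
      len M ∣ (z.pos - z.pos % len M + k * len M) % len z.top := fun {z} hz k =>
    (Nat.dvd_mod_iff (len_dvd hz)).2
      (dvd_add (Nat.dvd_sub_mod _) (Dvd.intro_left _ rfl))
  have hview : ∀ {z : Sys B}, M ≤ z.top → ((shift B)^[s] z).view M =
      some (B.word M (z.top - M) z.wd
        ((z.pos - z.pos % len M + (z.pos % len M + s) / len M * len M) % len z.top),
        (z.pos % len M + s) % len M) := by
    intro z hz
    rw [view_of_le (by rwa [top_iterate]), top_iterate, wd_iterate, pos_iterate, pos_decomp hz]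
    obtain ⟨c, hc⟩ := hdvd hz ((z.pos % len M + s) / len M)
    rw [hc]
    congr 2
    · refine B.word_congr _ _ _ ?_
      rw [Nat.mul_add_div hM, Nat.div_eq_of_lt (Nat.mod_lt _ hM), add_zero,
        Nat.mul_div_cancel_left _ hM]
    · rw [Nat.mul_add_mod, Nat.mod_mod]
  constructor
  · refine view_eq_of_le hi (by rwa [top_iterate]) (by rwa [top_iterate]) ?_
    rw [hview hx, hview hy, h3, hclock]
  · rw [pos_iterate, pos_iterate, pos_decomp hx, pos_decomp hy, Nat.add_eq_zero_iff,
      Nat.add_eq_zero_iff, h4, hclock]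

/-- The finitely many points of index below `M` are taken outright. For the others, the code records
a word and a mark bit per block; as `expo M + 1 ≤ 2 * len M`, this costs at most a factor 4 per unit
of time. -/
theorem exists_agree_net (B : BlockSystem) (M : ℕ) : ∃ C : ℕ, 1 ≤ C ∧ ∀ T, ∃ A : Finset (Sys B),
    A.card ≤ C * 4 ^ T ∧
      ∀ y, ∃ a ∈ A, ∀ t < T, Agree M ((shift B)^[t] a) ((shift B)^[t] y) := by
  classical
  refine ⟨(small B M).card + len M * 4 ^ (2 * M + 1 + 2 * len M), ?_, fun T => ?_⟩
  · exact le_add_left (Nat.mul_pos (len_pos M) (by positivity))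
  -- One extra block for rounding up and one for the offset of the initial clock.
  set K := (T + 2 * M) / len M + 2 with hK
  obtain ⟨A, hA, hcode⟩ := exists_finset_of_code (code (B := B) M K) fun x => M ≤ x.top
  refine ⟨small B M ∪ A.image ((shift B)^[M]), ?_, fun y => ?_⟩
  · have h1 : A.card ≤ len M * 4 ^ (2 * M + 1 + 2 * len M) * 4 ^ T := by
      refine hA.trans ?_
      rw [Fintype.card_prod, Fintype.card_fin, Fintype.card_fun, Fintype.card_prod,
        Fintype.card_fin, Fintype.card_fin, Fintype.card_prop, mul_assoc, ← pow_add]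
      refine Nat.mul_le_mul_left _ ?_
      rw [numWords, ← pow_succ, ← pow_mul, show 4 = 2 ^ 2 from rfl, ← pow_mul]
      refine Nat.pow_le_pow_right two_pos ?_
      have h2 := expo_le_len M
      have h3 := len_pos M
      have h4 : len M * K ≤ T + 2 * M + 2 * len M := by
        rw [hK, mul_add]
        have := Nat.mul_div_le (T + 2 * M) (len M)
        omega
      calc (expo M + 1) * K ≤ (2 * len M) * K := Nat.mul_le_mul_right _ (by omega)
        _ = 2 * (len M * K) := by ring
        _ ≤ 2 * (T + 2 * M + 2 * len M) := Nat.mul_le_mul_left _ h4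
        _ ≤ _ := by omega
    have h5 : (small B M).card ≤ (small B M).card * 4 ^ T :=
      Nat.le_mul_of_pos_right _ (by positivity)
    calc _ ≤ (small B M).card + (A.image ((shift B)^[M])).card := Finset.card_union_le _ _
      _ ≤ (small B M).card + A.card := Nat.add_le_add_left Finset.card_image_le _
      _ ≤ (small B M).card * 4 ^ T + len M * 4 ^ (2 * M + 1 + 2 * len M) * 4 ^ T :=
        Nat.add_le_add h5 h1
      _ = _ := by ring
  · by_cases hy : y.idx < M
    · exact ⟨y, Finset.mem_union_left _ (mem_small.2 hy), fun t _ => Agree.refl _ _⟩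
    -- Starting `M` steps earlier turns the window `[-M, M]` around each time `t < T` into
    -- nonnegative times at most `t + 2 * M`.
    have hsurj : Function.Surjective ((shift B)^[M]) := (shift B).surjective.iterate M
    obtain ⟨z, rfl⟩ := hsurj y
    have hz : M ≤ z.top := by
      rw [← top_iterate M z]
      unfold top
      omega
    obtain ⟨a, ha, haM, hac⟩ := hcode z hz
    refine ⟨_, Finset.mem_union_right _ (Finset.mem_image_of_mem _ ha), fun t ht => ?_⟩
    refine agree_of_iterates fun i hi s hs => obs_eq_of_code haM hz hac ?_ hi
    have h3 := Nat.div_add_mod (T + 2 * M) (len M)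
    have h4 := Nat.mod_lt (T + 2 * M) (len_pos M)
    rw [hK, show (T + 2 * M) / len M + 2 - 1 = (T + 2 * M) / len M + 1 from rfl, add_mul, one_mul,
      mul_comm _ (len M)]
    omega

end Sys

/-! ### Few separated points at the low times. -/

/-- Moving from one block of length `n` to a later one, past its first `l` positions, takes at least
`l` steps. -/
theorem div_eq_div_of_gap {a b n l : ℕ} (hn : 0 < n) (ha : l ≤ a % n) (hb : l ≤ b % n)
    (hab : a < b + l) (hba : b < a + l) : a / n = b / n := by
  have key : ∀ {a b : ℕ}, l ≤ b % n → b < a + l → b / n ≤ a / n := by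
    intro a b hb hba
    rw [Nat.le_div_iff_mul_le hn]
    have := Nat.div_add_mod' b n
    omega
  exact le_antisymm (key ha hab) (key hb hba)

namespace Sys

variable {B : BlockSystem}

/-- Points distinguished by their words of level `k + 2` within `len k` steps are distinguished
in the same block of level `k + 1`, hence there are few of them. -/
theorem card_le_of_farAt {k : ℕ} {A : Finset (Sys B)} (htop : ∀ x ∈ A, k + 2 ≤ x.top)
    (hA : ∀ x ∈ A, ∀ y ∈ A, x ≠ y → ∃ t < len k,
      ViewFar B (k + 2) (((shift B)^[t] x).view (k + 2)) (((shift B)^[t] y).view (k + 2))) :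
    A.card ≤ 2 * expo (k + 2) + 2 := by
  classical
  set W : ℕ → Sys B → ℕ := fun t x =>
    B.word (k + 2) (x.top - (k + 2)) x.wd ((x.pos + t) % len x.top) with hW
  have hdvd : ∀ x ∈ A, len (k + 2) ∣ len x.top := fun x hx => len_dvd (htop x hx)
  have hdvd1 : len (k + 1) ∣ len (k + 2) := len_dvd (by omega)
  have hWlt : ∀ t, ∀ x ∈ A, W t x < numWords (k + 2) := fun t x hx =>
    B.word_lt _ _ (by rw [Nat.add_sub_cancel' (htop x hx)]; exact x.wd_lt) _
  have hA' : ∀ x ∈ A, ∀ y ∈ A, x ≠ y → ∃ t < len k,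
      (x.pos + t) % len (k + 2) = (y.pos + t) % len (k + 2) ∧
        B.FarAt (k + 2) (W t x) (W t y) ((x.pos + t) % len (k + 2)) := by
    intro x hx y hy hxy
    obtain ⟨t, ht, h⟩ := hA x hx y hy hxy
    refine ⟨t, ht, ?_⟩
    rw [view_of_le (by rw [top_iterate]; exact htop x hx),
      view_of_le (by rw [top_iterate]; exact htop y hy)] at h
    simp only [top_iterate, wd_iterate, pos_iterate] at h
    rw [Nat.mod_mod_of_dvd _ (hdvd x hx), Nat.mod_mod_of_dvd _ (hdvd y hy)] at h
    exact h
  rcases le_or_gt A.card 1 with hcard | hcard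
  · omega
  -- Views can be far only at equal positions, so all clocks agree modulo `len (k + 2)`.
  have hclock : ∀ x ∈ A, ∀ y ∈ A, ∀ t, (x.pos + t) % len (k + 2) = (y.pos + t) % len (k + 2) := by
    intro x hx y hy t
    by_cases hxy : x = y
    · rw [hxy]
    · obtain ⟨t', _, h, _⟩ := hA' x hx y hy hxy
      exact Nat.ModEq.add_right t (Nat.ModEq.add_right_cancel' t' h)
  have hclock1 : ∀ x ∈ A, ∀ y ∈ A, ∀ t,
      (x.pos + t) % len (k + 1) = (y.pos + t) % len (k + 1) := by
    intro x hx y hy t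
    rw [← Nat.mod_mod_of_dvd _ hdvd1, hclock x hx y hy t, Nat.mod_mod_of_dvd _ hdvd1]
  -- The constant first block of each word of level `k + 1` never distinguishes; with a window of
  -- `len k` steps, all distinguishing times therefore lie in one block of level `k + 1`.
  have hgap : ∀ x ∈ A, ∀ y ∈ A, ∀ t,
      B.FarAt (k + 2) (W t x) (W t y) ((x.pos + t) % len (k + 2)) →
      len k ≤ (x.pos + t) % len (k + 1) := by
    intro x hx y hy t h
    have := B.len_le_of_farAt (B.b_lt _ _ _) (B.b_lt _ _ _) h.2
    rwa [Nat.mod_mod_of_dvd _ hdvd1] at this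
  obtain ⟨x₀, hx₀, y₀, hy₀, hne₀⟩ := Finset.one_lt_card.1 hcard
  obtain ⟨t₀, ht₀, -, hfar₀⟩ := hA' x₀ hx₀ y₀ hy₀ hne₀
  have hgap₀ := hgap x₀ hx₀ y₀ hy₀ t₀ hfar₀
  have hblock : ∀ x ∈ A, ∀ t < len k, len k ≤ (x.pos + t) % len (k + 1) →
      (x.pos + t) / len (k + 1) = (x.pos + t₀) / len (k + 1) := by
    intro x hx t ht h
    refine div_eq_div_of_gap (len_pos _) h ?_ (by omega) (by omega)
    rw [hclock1 x hx x₀ hx₀]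
    exact hgap₀
  have key : ∀ x ∈ A, ∀ y ∈ A, x ≠ y → W t₀ x ≠ W t₀ y ∧
      B.κ (k + 1) (W t₀ x) (W t₀ y) = (x₀.pos + t₀) % len (k + 2) / len (k + 1) := by
    intro x hx y hy hxy
    obtain ⟨t, ht, -, hfar⟩ := hA' x hx y hy hxy
    have hg := hgap x hx y hy t hfar
    have hbx := hblock x hx t ht hg
    have hby := hblock y hy t ht (by rw [hclock1 y hy x hx]; exact hg)
    have hWt : ∀ z ∈ A, (z.pos + t) / len (k + 1) = (z.pos + t₀) / len (k + 1) →
        W t z = W t₀ z := fun z hz h =>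
      B.word_congr _ _ _ (mod_div_eq_of_dvd (div_eq_div_of_dvd h hdvd1) (hdvd z hz))
    rw [hWt x hx hbx, hWt y hy hby] at hfar
    refine ⟨fun h => B.farAt_irrefl _ _ _ (h ▸ hfar), ?_⟩
    rw [← hfar.1, mod_div_eq_of_dvd hbx hdvd1, hclock x hx x₀ hx₀]
  have hinj : Set.InjOn (W t₀) A := by
    intro x hx y hy h
    by_contra hxy
    exact (key x hx y hy hxy).1 h
  rw [← Finset.card_image_of_injOn hinj]
  refine Nat.le_of_lt_succ (B.clique (k + 1) ((x₀.pos + t₀) % len (k + 2) / len (k + 1)) _ ?_ ?_)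
  · intro u hu
    obtain ⟨x, hx, rfl⟩ := Finset.mem_image.1 hu
    exact hWlt _ x hx
  · intro u hu v hv huv
    obtain ⟨x, hx, rfl⟩ := Finset.mem_image.1 hu
    obtain ⟨y, hy, rfl⟩ := Finset.mem_image.1 hv
    exact (key x hx y hy fun h => huv (h ▸ rfl)).2

/-- Periods exceed the window, so each point shows at most one mark in it. Sorting by the time of
that mark gives at most `len k + 1` classes, and within a class only the words can distinguish. -/
theorem card_le_of_far {k : ℕ} {A : Finset (Sys B)} (htop : ∀ x ∈ A, k + 2 ≤ x.top)
    (hA : ∀ x ∈ A, ∀ y ∈ A, x ≠ y → ∃ t < len k,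
      Far (k + 2) ((shift B)^[t] x) ((shift B)^[t] y)) :
    A.card ≤ (2 * expo (k + 2) + 2) * (len k + 1) := by
  classical
  -- The first alternative gives the default value `len k` when no mark occurs in the window.
  set P : Sys B → ℕ → Prop := fun x t => len k ≤ t ∨ ((shift B)^[t] x).pos = 0 with hP
  have hex : ∀ x, ∃ t, P x t := fun x => ⟨len k, Or.inl le_rfl⟩
  set g : Sys B → ℕ := fun x => Nat.find (hex x) with hg
  have hg_le : ∀ x, g x ≤ len k := fun x => Nat.find_min' (hex x) (Or.inl le_rfl)
  have hmark : ∀ x ∈ A, ∀ t < len k, (((shift B)^[t] x).pos = 0 ↔ t = g x) := by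
    intro x hx t ht
    constructor
    · intro h
      have h1 : g x ≤ t := Nat.find_min' (hex x) (Or.inr h)
      have h2 : ((shift B)^[g x] x).pos = 0 :=
        (Nat.find_spec (hex x)).resolve_left (by change ¬ len k ≤ g x; omega)
      rw [pos_iterate] at h h2
      have h3 : x.pos + g x ≡ x.pos + t [MOD len x.top] := h2.trans h.symm
      have h4 := Nat.ModEq.add_left_cancel' x.pos h3
      have h5 : len k < len x.top := len_strictMono (by have := htop x hx; omega)
      exact (Nat.ModEq.eq_of_lt_of_lt h4 (by omega) (by omega)).symm
    · rintro rfl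
      exact (Nat.find_spec (hex x)).resolve_left (not_le.2 ht)
  refine (Finset.card_le_mul_card_image (f := g) A (2 * expo (k + 2) + 2) ?_).trans ?_
  · intro c _
    refine card_le_of_farAt (fun x hx => htop x (Finset.mem_filter.1 hx).1) ?_
    intro x hx y hy hxy
    obtain ⟨hx, hgx⟩ := Finset.mem_filter.1 hx
    obtain ⟨hy, hgy⟩ := Finset.mem_filter.1 hy
    obtain ⟨t, ht, h⟩ := hA x hx y hy hxy
    refine ⟨t, ht, (h.resolve_left ?_) _ le_rfl⟩
    rw [not_not, hmark x hx t ht, hmark y hy t ht, hgx, hgy]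
  · refine Nat.mul_le_mul_left _ ?_
    refine (Finset.card_le_card (t := Finset.range (len k + 1)) ?_).trans_eq
      (Finset.card_range _)
    intro c hc
    obtain ⟨x, _, rfl⟩ := Finset.mem_image.1 hc
    exact Finset.mem_range.2 (Nat.lt_succ_of_le (hg_le x))

theorem card_separated_le (B : BlockSystem) (j : ℕ) {A : Finset (Sys B)}
    (hA : ∀ x ∈ A, ∀ y ∈ A, x ≠ y → ∃ t < len (3 * j + 1),
      Far (3 * j + 3) ((shift B)^[t] x) ((shift B)^[t] y)) :
    A.card ≤ (j + 1) * (numWords (3 * j) * len (3 * j)) +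
      (2 * expo (3 * j + 3) + 2) * (len (3 * j + 1) + 1) := by
  classical
  rw [← Finset.card_filter_add_card_filter_not (s := A) (fun x => x.idx < j + 1)]
  refine Nat.add_le_add ((Finset.card_le_card fun x hx => ?_).trans (card_small_succ_le B j)) ?_
  · exact mem_small.2 (Finset.mem_filter.1 hx).2
  · refine card_le_of_far (k := 3 * j + 1) (fun x hx => ?_) fun x hx y hy hxy => ?_
    · have := (Finset.mem_filter.1 hx).2
      unfold top
      omega
    · exact hA x (Finset.mem_filter.1 hx).1 y (Finset.mem_filter.1 hy).1 hxy

/-! ### Many points needed at the high times. -/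

/-- The periodic point of level `3 * j` with label `u` at the beginning of its period. -/
def start (B : BlockSystem) (j : ℕ) (u : Fin (numWords (3 * j))) : Sys B := ⟨j, u, 0⟩

theorem start_pos (j : ℕ) (u : Fin (numWords (3 * j))) : (start B j u).pos = 0 := ZMod.val_zero

theorem start_injective (B : BlockSystem) (j : ℕ) : Function.Injective (start B j) := by
  intro u v h
  simpa [start] using h

theorem mark_iff_of_dist_lt {x y : Sys B} (h : dist x y < 1) : x.pos = 0 ↔ y.pos = 0 := by
  obtain ⟨m, hm⟩ := exists_not_far h
  by_contra hne
  exact hm (Or.inl hne)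

/-- Different marks force distance 1, so the marks coincide over two periods, which determines the
period and phase of `a`. If the words differed, then at their distinguishing position all levels up
to `3 * j` would be far, and higher levels are vacuously far, giving distance 1 again. -/
theorem eq_start_of_dist_lt {j : ℕ} {u : Fin (numWords (3 * j))} {a : Sys B}
    (h : ∀ t < 2 * len (3 * j), dist ((shift B)^[t] a) ((shift B)^[t] (start B j u)) < 1) :
    a = start B j u := by
  have hpos := len_pos (3 * j)
  have hmark : ∀ t < 2 * len (3 * j),
      ((a.pos + t) % len a.top = 0 ↔ t % len (3 * j) = 0) := by
    intro t ht
    have := mark_iff_of_dist_lt (h t ht)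
    rw [pos_iterate, pos_iterate, start_pos, zero_add] at this
    exact this
  have ha0 : a.pos = 0 := by
    have := (hmark 0 (by omega)).2 (Nat.zero_mod _)
    rwa [add_zero, Nat.mod_eq_of_lt a.pos_lt] at this
  simp only [ha0, zero_add] at hmark
  have h1 : len a.top ∣ len (3 * j) :=
    Nat.dvd_of_mod_eq_zero ((hmark _ (by omega)).2 (Nat.mod_self _))
  have h2 : len (3 * j) ∣ len a.top := by
    have := Nat.le_of_dvd hpos h1
    exact Nat.dvd_of_mod_eq_zero ((hmark _ (by omega)).1 (Nat.mod_self _))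
  have htop : a.top = 3 * j := len_strictMono.injective (Nat.dvd_antisymm h1 h2)
  refine ext_iff'.2 ⟨htop, ?_, ha0.trans (start_pos j u).symm⟩
  by_contra hne
  obtain ⟨p, hp, hfar⟩ := B.exists_farAt (3 * j) (htop ▸ a.wd_lt) (start B j u).wd_lt hne
  obtain ⟨m, hm⟩ := exists_not_far (h p (by omega))
  refine hm (Or.inr fun i _ => ?_)
  have htop' : (start B j u).top = 3 * j := rfl
  rcases le_or_gt i (3 * j) with hi | hi
  · rw [view_of_le (by rw [top_iterate, htop]; exact hi),
      view_of_le (by rw [top_iterate, htop']; exact hi)]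
    simp only [top_iterate, wd_iterate, pos_iterate, ha0, start_pos, htop, htop', zero_add]
    rw [Nat.mod_eq_of_lt hp]
    obtain ⟨d, hd⟩ := Nat.exists_eq_add_of_le hi
    rw [hd] at hp hfar ⊢
    rw [Nat.add_sub_cancel_left]
    exact ⟨rfl, B.farAt_word hp hfar⟩
  · rw [view_of_lt (by rw [top_iterate, htop]; exact hi),
      view_of_lt (by rw [top_iterate, htop']; exact hi)]
    trivial

end Sys

/-! ### Numerical estimates. -/

/-- The bound for the separation numbers at time `len (3 * j + 1)`. -/
def sepBound (j : ℕ) : ℕ :=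
  (j + 1) * (numWords (3 * j) * len (3 * j)) +
    (2 * expo (3 * j + 3) + 2) * (len (3 * j + 1) + 1)

theorem pow_le_len (m : ℕ) : 8 ^ m ≤ len m := by
  induction m with
  | zero => exact le_rfl
  | succ m ih =>
    rw [len_succ, pow_succ, mul_comm]
    exact Nat.mul_le_mul (numBlocks_ge m) ih

theorem sepBound_le (j : ℕ) :
    sepBound j ≤ 2 ^ 13 * (2 ^ (3 * len (3 * j)) * len (3 * j + 1) ^ 3) := by
  set l := len (3 * j) with hl
  set T := len (3 * j + 1) with hT
  have hl1 : j + 1 ≤ l := by have := lt_len (3 * j); omega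
  have hl2 : l ≤ 2 ^ l := Nat.lt_two_pow_self.le
  have hT1 : 1 ≤ T := len_pos _
  have h1 : (j + 1) * (numWords (3 * j) * l) ≤ 2 ^ (3 * l) := by
    have hN : numWords (3 * j) ≤ 2 ^ l := Nat.pow_le_pow_right two_pos (expo_le_len _)
    calc (j + 1) * (numWords (3 * j) * l) ≤ 2 ^ l * (2 ^ l * 2 ^ l) :=
          Nat.mul_le_mul (hl1.trans hl2) (Nat.mul_le_mul hN hl2)
      _ = 2 ^ (3 * l) := by ring
  have h2 : expo (3 * j + 3) ≤ 2 ^ 9 * T ^ 2 := by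
    refine (expo_le_len _).trans ?_
    have h8 : 2 ^ (6 * j) ≤ T := by
      refine le_trans ?_ (pow_le_len (3 * j + 1))
      rw [show 8 = 2 ^ 3 from rfl, ← pow_mul]
      exact Nat.pow_le_pow_right two_pos (by omega)
    calc len (3 * j + 3) = 2 ^ (3 * j + 5) * (2 ^ (3 * j + 4) * T) := rfl
      _ = 2 ^ 9 * (2 ^ (6 * j) * T) := by ring
      _ ≤ 2 ^ 9 * (T * T) := Nat.mul_le_mul_left _ (Nat.mul_le_mul_right _ h8)
      _ = _ := by ring
  have h3 : (2 * expo (3 * j + 3) + 2) * (T + 1) ≤ 2 ^ 12 * T ^ 3 := by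
    have hT2 : 1 ≤ T ^ 2 := Nat.one_le_pow _ _ hT1
    calc (2 * expo (3 * j + 3) + 2) * (T + 1)
        ≤ (2 ^ 11 * T ^ 2) * (2 * T) := Nat.mul_le_mul (by omega) (by omega)
      _ = _ := by ring
  have h4 : 1 ≤ 2 ^ (3 * l) := Nat.one_le_two_pow
  have h5 : 1 ≤ T ^ 3 := Nat.one_le_pow _ _ hT1
  unfold sepBound
  calc _ ≤ 2 ^ (3 * l) + 2 ^ 12 * T ^ 3 := Nat.add_le_add h1 h3
    _ ≤ 2 ^ 12 * (2 ^ (3 * l) * T ^ 3) + 2 ^ 12 * (2 ^ (3 * l) * T ^ 3) := by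
        refine Nat.add_le_add ?_ (Nat.mul_le_mul_left _ (Nat.le_mul_of_pos_left _ h4))
        calc 2 ^ (3 * l) ≤ 2 ^ (3 * l) * T ^ 3 := Nat.le_mul_of_pos_right _ h5
          _ ≤ _ := Nat.le_mul_of_pos_left _ (by norm_num)
    _ = _ := by ring

theorem sepBound_pos (j : ℕ) : 1 ≤ sepBound j := by
  refine le_add_left (Nat.mul_pos ?_ ?_) <;> omega

theorem eventually_log_sepBound_le :
    ∀ᶠ j : ℕ in atTop, Real.log (sepBound j) ≤ 1 / 16 * (len (3 * j + 1) : ℝ) := by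
  have hT : Tendsto (fun j => ((len (3 * j + 1) : ℕ) : ℝ)) atTop atTop := by
    refine tendsto_natCast_atTop_atTop.comp (len_strictMono.tendsto_atTop.comp ?_)
    exact tendsto_atTop_mono (fun j => by simp only [id]; omega) tendsto_id
  -- With `T = len (3 * j + 1)`, the contributions are `1 / 64` from the constant, `3 / 128` from `2
  -- ^ (3 * len (3 * j))` and `3 / 192` from `T ^ 3`: together `7 / 128 < 1 / 16`.
  have hlog : ∀ᶠ x : ℝ in atTop, Real.log x ≤ 1 / 192 * x := by
    have := Real.isLittleO_log_id_atTop.bound (show (0 : ℝ) < 1 / 192 by norm_num)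
    filter_upwards [this, eventually_ge_atTop 0] with x hx h0
    simp only [id, Real.norm_eq_abs, abs_of_nonneg h0] at hx
    exact (le_abs_self _).trans hx
  have hbig : ∀ᶠ x : ℝ in atTop, 13 * Real.log 2 ≤ 1 / 64 * x := by
    filter_upwards [eventually_ge_atTop (64 * (13 * Real.log 2))] with x hx
    linarith
  filter_upwards [hT.eventually hlog, hT.eventually hbig, eventually_ge_atTop 2] with j h1 h2 hj
  have hl : (128 * len (3 * j) : ℝ) ≤ len (3 * j + 1) := by
    have h : 128 ≤ numBlocks (3 * j) := by
      unfold numBlocks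
      calc 128 = 2 ^ 7 := rfl
        _ ≤ _ := Nat.pow_le_pow_right two_pos (by omega)
    have := Nat.mul_le_mul_right (len (3 * j)) h
    rw [← len_succ] at this
    exact_mod_cast this
  have hT0 : (0 : ℝ) < len (3 * j + 1) := by exact_mod_cast len_pos _
  have hle : (sepBound j : ℝ) ≤ 2 ^ 13 * (2 ^ (3 * len (3 * j)) * (len (3 * j + 1) : ℝ) ^ 3) := by
    exact_mod_cast sepBound_le j
  have hpos : (0 : ℝ) < sepBound j := by exact_mod_cast sepBound_pos j
  have h3 := Real.log_le_log hpos hle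
  rw [Real.log_mul (by positivity) (by positivity), Real.log_mul (by positivity) (by positivity),
    Real.log_pow, Real.log_pow, Real.log_pow] at h3
  push_cast at h3
  have h4 : Real.log 2 ≤ 1 := by linarith [Real.log_two_lt_d9]
  have h5 : (0 : ℝ) ≤ len (3 * j) := Nat.cast_nonneg _
  have h6 : (len (3 * j) : ℝ) * Real.log 2 ≤ len (3 * j) := mul_le_of_le_one_right h5 h4
  linarith

end BowenEntropy

/-! ### Assembly. -/

theorem theorem1 :
    ∃ (X : Type) (_ : MetricSpace X) (_ : CompactSpace X) (F : X ≃ₜ X),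
      (∃ ε : ℝ, 0 < ε ∧
        liminf (fun T : ℕ =>
            BowenEntropy.rate (BowenEntropy.spanNum (BowenEntropy.dynDist F T) ε) T) atTop <
          limsup (fun T : ℕ =>
            BowenEntropy.rate (BowenEntropy.spanNum (BowenEntropy.dynDist F T) ε) T) atTop ∧
        liminf (fun T : ℕ =>
            BowenEntropy.rate (BowenEntropy.sepNum (BowenEntropy.dynDist F T) ε) T) atTop <
          limsup (fun T : ℕ =>
            BowenEntropy.rate (BowenEntropy.sepNum (BowenEntropy.dynDist F T) ε) T) atTop) ∧
      ∃ h : ℝ,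
        Tendsto (fun ε : ℝ => limsup (fun T : ℕ =>
            BowenEntropy.rate (BowenEntropy.covNum (BowenEntropy.dynDist F T) ε) T) atTop)
          (𝓝[>] 0) (𝓝 (h : EReal)) ∧
        Tendsto (fun ε : ℝ => limsup (fun T : ℕ =>
            BowenEntropy.rate (BowenEntropy.sepNum (BowenEntropy.dynDist F T) ε) T) atTop)
          (𝓝[>] 0) (𝓝 (h : EReal)) ∧
        Tendsto (fun ε : ℝ => limsup (fun T : ℕ =>
            BowenEntropy.rate (BowenEntropy.spanNum (BowenEntropy.dynDist F T) ε) T) atTop)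
          (𝓝[>] 0) (𝓝 (h : EReal)) := by
  open BowenEntropy in
  classical
  obtain ⟨B⟩ := nonempty_blockSystem
  have : Nonempty (Sys B) := ⟨⟨0, ⟨0, by unfold numWords; positivity⟩, 0⟩⟩
  have htend : ∀ c : ℕ, Tendsto (fun j => len (3 * j + c)) atTop atTop := fun c =>
    len_strictMono.tendsto_atTop.comp (tendsto_atTop_mono (fun j => by simp only [id]; omega) tendsto_id)
  refine exists_compact_system (Sys.shiftUniform B) (b := 4) (by norm_num) ?_
    -- The high rate is at least `expo (3 * j) * log 2 / (2 * len (3 * j)) ≥ log 2 / 4`, which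
    -- exceeds `1 / 8`.
    (c := 1 / 16) (c' := 1 / 8) (by norm_num) ?_ ?_
  · intro ε hε
    obtain ⟨M, hM⟩ := Sys.exists_agree_scale (B := B) hε
    obtain ⟨C, hC, h⟩ := Sys.exists_agree_net B M
    refine ⟨C, hC, fun T => ?_⟩
    obtain ⟨A, hA, hnet⟩ := h T
    refine ⟨A, hA, fun y => ?_⟩
    obtain ⟨a, ha, hay⟩ := hnet y
    exact ⟨a, ha, fun t ht => hM _ _ (hay t ht)⟩
  · refine (htend 1).frequently (Eventually.frequently ?_)
    filter_upwards [eventually_log_sepBound_le] with j hj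
    -- This is the weight of level `3 * j + 3`: a larger deficit from 1 would no longer force that
    -- level to be far.
    refine ⟨(1 / 2 : ℝ) ^ (3 * j + 3 + 2), by positivity,
      pow_lt_one₀ (by norm_num) (by norm_num) (by omega), sepBound j, sepBound_pos j, hj, ?_⟩
    intro A hA
    refine Sys.card_separated_le B j fun x hx y hy hxy => ?_
    obtain ⟨t, ht, h⟩ := hA x hx y hy hxy
    exact ⟨t, ht, Sys.far_of_lt_dist h⟩
  · have htend2 : Tendsto (fun j => 2 * len (3 * j + 0)) atTop atTop :=
      tendsto_atTop_mono (fun j => by omega) (htend 0)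
    refine htend2.frequently (Eventually.frequently (Eventually.of_forall fun j => ?_))
    have hcard : (Finset.univ.image (Sys.start B j)).card = 2 ^ expo (3 * j) := by
      rw [Finset.card_image_of_injective _ (Sys.start_injective B j), Finset.card_univ,
        Fintype.card_fin]
      rfl
    refine ⟨Finset.univ.image (Sys.start B j), ?_, ?_, ?_⟩
    · rw [hcard]
      exact Nat.one_le_two_pow
    · rw [hcard]
      push_cast
      rw [Real.log_pow]
      have h1 : (len (3 * j) : ℝ) ≤ 2 * expo (3 * j) := by
        exact_mod_cast len_le_two_mul_expo (3 * j)
      have h2 := Real.log_two_gt_d9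
      have h3 : (0 : ℝ) ≤ expo (3 * j) := Nat.cast_nonneg _
      simp only [add_zero]
      nlinarith
    · intro u hu v hv a hau hav
      obtain ⟨u, _, rfl⟩ := Finset.mem_image.1 hu
      obtain ⟨v, _, rfl⟩ := Finset.mem_image.1 hv
      exact (Sys.eq_start_of_dist_lt hau).symm.trans (Sys.eq_start_of_dist_lt hav)
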